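/- Let $J_L\in C^2(\mathbb R^2)$ and $J_F\in C^3(\mathbb R^2)$ be real-valued and assume: - for each $x_1\in\mathbb R$ the equation $\partial_{x_2}J_F(x_1,x_2)=0$ has a unique root $x_2=h(x_1)$, and $h\in C^1(\mathbb R)$; - there is $m_2>0$ with $\partial^2_{x_2x_2}J_F(x_1,x_2)\ge m_2$ for all $(x_1,x_2)\in\mathbb R^2$; - with $\tilde J_L(x_1):=J_L(x_1,h(x_1))$, there are $x_1^*\in\mathbb R$ with $\tilde J_L'(x_1^*)=0$ and $m_1>0$ with $\tilde J_L''(x_1)\ge m_1$ for all $x_1\in\mathbb R$. Put $x^*=(x_1^*,h(x_1^*))$. Fix $\alpha_1,k_1,\alpha_2>0$ and consider, for $\omega_1,\omega_2,k_2>0$, with $\varepsilon:=1/(\alpha_2k_2)$, the two-level nested extremum-seeking system $$\dot x_1=\sqrt{\alpha_1\omega_1}\cos\big(\omega_1t+k_1J_L(x_1,x_2)\big),\qquad \dot x_2=\sqrt{\alpha_2\omega_2}\cos\big(\omega_2t+k_2J_F(x_1,x_2)\big).$$ Then there are positive thresholds $\omega_1^*(\upsilon)$, $\varepsilon^*(\upsilon,\omega_1)$,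 $\omega_2^*(\upsilon,\omega_1,\varepsilon)$ such that, for parameters with $\omega_1>\omega_1^*(\upsilon)$, $0<\varepsilon<\varepsilon^*(\upsilon,\omega_1)$ and $\omega_2>\omega_2^*(\upsilon,\omega_1,\varepsilon)$, the system is $\upsilon$-semi-globally practically uniformly asymptotically stable to $x^*$, that is: there are $\beta\in\mathcal{KL}$ and $\sigma\in\mathcal K_\infty$ such that for every compact $K\subset\mathbb R^2$ there is $\upsilon^*>0$ such that, for every $0<\upsilon<\upsilon^*$, all parameters as above, all $t_0\in\mathbb R$ and all $x_0\in K$, a solution with $x(t_0)=x_0$ exists on $[t_0,\infty)$, and every such solution satisfies $$\|x(t)-x^*\|\le\beta(\|x_0-x^*\|,t-t_0)+\sigma(\upsilon)\qquad\text{for all }t\ge t_0.$$ -/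

import Mathlib

/-- Class `𝒦`: continuous, strictly increasing on `[0, ∞)`, and zero at zero. -/
structure IsClassK (σ : ℝ → ℝ) : Prop where
  continuousOn : ContinuousOn σ (Set.Ici 0)
  strictMonoOn : StrictMonoOn σ (Set.Ici 0)
  map_zero : σ 0 = 0

/-- Class `𝒦_∞`: class `𝒦` and unbounded. -/
structure IsClassKInf (σ : ℝ → ℝ) : Prop extends IsClassK σ where
  tendsto_atTop : Filter.Tendsto σ Filter.atTop Filter.atTop

/-- Class `𝒦ℒ`: continuous on `[0, ∞) × [0, ∞)`, of class `𝒦` in the first argument, and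
decreasing to zero in the second argument. -/
structure IsClassKL (β : ℝ → ℝ → ℝ) : Prop where
  continuousOn : ContinuousOn (Function.uncurry β) (Set.Ici 0 ×ˢ Set.Ici 0)
  isClassK : ∀ s, 0 ≤ s → IsClassK fun r => β r s
  antitoneOn : ∀ r, 0 ≤ r → AntitoneOn (β r) (Set.Ici 0)
  tendsto_zero : ∀ r, 0 ≤ r → Filter.Tendsto (β r) Filter.atTop (nhds 0)

/-- Semi-global practical uniform asymptotic stability of the point `xs`, as `υ → 0⁺`, for the
systems `ẋ = f t x`, where `F υ` is the set of vector fields `f` that are admissible for `υ`.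
The functions `β` and `σ` are the same for all compact sets `K` of initial conditions, all `υ`, all
admissible `f` and all initial times; only `υs` depends on `K`. -/
def IsSPUAS {E : Type*} [NormedAddCommGroup E] [NormedSpace ℝ E]
    (F : ℝ → Set (ℝ → E → E)) (xs : E) : Prop :=
  ∃ (β : ℝ → ℝ → ℝ) (σ : ℝ → ℝ), IsClassKL β ∧ IsClassKInf σ ∧
    ∀ K : Set E, IsCompact K → ∃ υs : ℝ, 0 < υs ∧
      ∀ υ : ℝ, 0 < υ → υ < υs → ∀ f ∈ F υ, ∀ t₀ : ℝ, ∀ x₀ ∈ K,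
        (∃ x : ℝ → E, x t₀ = x₀ ∧ IsIntegralCurveOn x f (Set.Ici t₀)) ∧
        ∀ x : ℝ → E, x t₀ = x₀ → IsIntegralCurveOn x f (Set.Ici t₀) →
          ∀ t : ℝ, t₀ ≤ t → ‖x t - xs‖ ≤ β ‖x₀ - xs‖ (t - t₀) + σ υ

/-- The two-level nested extremum-seeking vector field
`(√(α₁ω₁) cos(ω₁ t + k₁ J_L(x₁, x₂)), √(α₂ω₂) cos(ω₂ t + k₂ J_F(x₁, x₂)))`. -/
noncomputable def nesField (JL JF : ℝ → ℝ → ℝ) (α₁ k₁ ω₁ α₂ k₂ ω₂ : ℝ)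
    (t : ℝ) (x : EuclideanSpace ℝ (Fin 2)) : EuclideanSpace ℝ (Fin 2) :=
  !₂[√(α₁ * ω₁) * Real.cos (ω₁ * t + k₁ * JL (x 0) (x 1)),
     √(α₂ * ω₂) * Real.cos (ω₂ * t + k₂ * JF (x 0) (x 1))]

/-- A bounded vector field that is Lipschitz on balls, uniformly in time, has forward global
integral curves. -/
theorem exists_isIntegralCurveOn_Ici_of_bounded {E : Type*} [NormedAddCommGroup E]
    [NormedSpace ℝ E] [CompleteSpace E] {f : ℝ → E → E} {L : ℝ} (hL : ∀ t x, ‖f t x‖ ≤ L)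
    (hc : ∀ x, Continuous fun t => f t x)
    (hlip : ∀ R : ℝ, ∃ K, ∀ t, LipschitzOnWith K (f t) (Metric.closedBall 0 R))
    (t₀ : ℝ) (x₀ : E) :
    ∃ x : ℝ → E, x t₀ = x₀ ∧ IsIntegralCurveOn x f (Set.Ici t₀) := by
  have hL0 : 0 ≤ L := (norm_nonneg _).trans (hL t₀ x₀)
  have hex : ∀ n : ℕ, ∃ α : ℝ → E, α t₀ = x₀ ∧ ∀ t ∈ Set.Icc t₀ (t₀ + n),
      HasDerivWithinAt α (f t (α t)) (Set.Icc t₀ (t₀ + n)) t := by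
    intro n
    obtain ⟨K, hK⟩ := hlip (‖x₀‖ + L * n)
    have hpl : IsPicardLindelof f (tmin := t₀) (tmax := t₀ + n)
        ⟨t₀, Set.left_mem_Icc.2 (by simp)⟩ x₀ (L * n).toNNReal 0 L.toNNReal K := by
      refine ⟨fun t _ => (hK t).mono ?_, fun x _ => (hc x).continuousOn, fun t _ x _ => ?_, ?_⟩
      · intro y hy
        rw [Metric.mem_closedBall, Real.coe_toNNReal _ (by positivity)] at hy
        rw [mem_closedBall_zero_iff]
        have := norm_le_norm_add_norm_sub' y x₀
        rw [dist_eq_norm] at hy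
        linarith
      · rw [Real.coe_toNNReal _ hL0]
        exact hL t x
      · rw [Real.coe_toNNReal _ hL0, Real.coe_toNNReal _ (by positivity)]
        simp
    exact hpl.exists_eq_forall_mem_Icc_hasDerivWithinAt₀
  choose α hα0 hα using hex
  have huniq : ∀ n m : ℕ, n ≤ m → Set.EqOn (α n) (α m) (Set.Icc t₀ (t₀ + n)) := by
    intro n m hnm
    have hnm' : (n : ℝ) ≤ m := by exact_mod_cast hnm
    have hsub : Set.Icc t₀ (t₀ + n) ⊆ Set.Icc t₀ (t₀ + m) :=
      Set.Icc_subset_Icc_right (by linarith)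
    have hcn : ContinuousOn (α n) (Set.Icc t₀ (t₀ + n)) :=
      fun t ht => (hα n t ht).continuousWithinAt
    have hcm : ContinuousOn (α m) (Set.Icc t₀ (t₀ + n)) :=
      fun t ht => ((hα m t (hsub ht)).mono hsub).continuousWithinAt
    obtain ⟨R₁, hR₁⟩ := isCompact_Icc.exists_bound_of_continuousOn hcn
    obtain ⟨R₂, hR₂⟩ := isCompact_Icc.exists_bound_of_continuousOn hcm
    obtain ⟨K, hK⟩ := hlip (max R₁ R₂)
    refine ODE_solution_unique_of_mem_Icc_right (v := f) (K := K)
      (s := fun _ => Metric.closedBall 0 (max R₁ R₂)) (fun t _ => hK t) hcn ?_ ?_ hcm ?_ ?_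
      (by rw [hα0, hα0])
    · intro t ht
      exact (hα n t (Set.Ico_subset_Icc_self ht)).mono_of_mem_nhdsWithin
        (Icc_mem_nhdsGE_of_mem ht)
    · intro t ht
      exact mem_closedBall_zero_iff.2
        ((hR₁ t (Set.Ico_subset_Icc_self ht)).trans (le_max_left _ _))
    · intro t ht
      exact ((hα m t (hsub (Set.Ico_subset_Icc_self ht))).mono hsub).mono_of_mem_nhdsWithin
        (Icc_mem_nhdsGE_of_mem ht)
    · intro t ht
      exact mem_closedBall_zero_iff.2
        ((hR₂ t (Set.Ico_subset_Icc_self ht)).trans (le_max_right _ _))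
  have hglue : ∀ N : ℕ, ∀ t ∈ Set.Icc t₀ (t₀ + N), α ⌈t - t₀⌉₊ t = α N t := by
    intro N t ht
    have h1 : t - t₀ ≤ ⌈t - t₀⌉₊ := Nat.le_ceil _
    rcases le_total ⌈t - t₀⌉₊ N with h | h
    · exact huniq _ _ h ⟨ht.1, by linarith⟩
    · exact (huniq _ _ h ht).symm
  refine ⟨fun t => α ⌈t - t₀⌉₊ t, hα0 _, fun t ht => ?_⟩
  rw [Set.mem_Ici] at ht
  obtain ⟨N, hN⟩ := exists_nat_gt (t - t₀)
  have htN : t ∈ Set.Icc t₀ (t₀ + N) := ⟨ht, by linarith⟩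
  have hd : HasDerivWithinAt (fun t => α ⌈t - t₀⌉₊ t) (f t (α ⌈t - t₀⌉₊ t))
      (Set.Icc t₀ (t₀ + N)) t := by
    rw [hglue N t htN]
    exact (hα N t htN).congr (hglue N) (hglue N t htN)
  refine hd.mono_of_mem_nhdsWithin ?_
  have : Set.Iio (t₀ + N) ∈ nhds t := Iio_mem_nhds (by linarith)
  filter_upwards [mem_nhdsWithin_of_mem_nhds this, self_mem_nhdsWithin] with s hs1 hs2
  exact ⟨hs2, le_of_lt hs1⟩

/-- If a continuous `g` is negative at every time up to which it has been nonpositive, then it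
remains nonpositive. -/
theorem nonpos_of_forall_le_nonpos_imp_neg {g : ℝ → ℝ} {t₀ : ℝ}
    (hg : ContinuousOn g (Set.Ici t₀)) (h₀ : g t₀ ≤ 0)
    (hstep : ∀ t, t₀ ≤ t → (∀ s ∈ Set.Icc t₀ t, g s ≤ 0) → g t < 0) :
    ∀ t, t₀ ≤ t → g t ≤ 0 := by
  intro t ht
  have hsub : Set.Icc t₀ t ⊆ {s | g s ≤ 0} := by
    refine IsClosed.Icc_subset_of_forall_mem_nhdsGT_of_Icc_subset ?_ h₀ ?_
    · rw [Set.inter_comm]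
      exact (hg.mono Set.Icc_subset_Ici_self).preimage_isClosed_of_isClosed isClosed_Icc
        isClosed_Iic
    · intro s hs hss
      have hneg := hstep s hs.1 hss
      have hc : ContinuousWithinAt g (Set.Ioi s) s :=
        (hg s hs.1).mono fun r hr => hs.1.trans (le_of_lt hr)
      filter_upwards [hc.eventually_lt_const hneg] with r hr using hr.le
  exact hsub ⟨ht, le_rfl⟩

/-- One-sided comparison with an exponential barrier. The function `u` is the quantity that
contracts, and `y` is a small perturbation of it. -/
theorem le_exp_barrier {y y' u : ℝ → ℝ} {t₀ T η μ ρ κ K ν Y : ℝ}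
    (hμ : 0 < μ) (hK : 0 ≤ K) (hν : μ ≤ ν) (hκ : η + ρ / μ < κ) (hρ : 0 ≤ ρ)
    (hY : y t₀ ≤ Y) (hY0 : 0 ≤ Y)
    (hy : ∀ t ∈ Set.Icc t₀ T, HasDerivWithinAt y (y' t) (Set.Ici t₀) t)
    (hη : ∀ t ∈ Set.Icc t₀ T, y t - η ≤ u t) (hη0 : 0 ≤ η)
    (hu : ∀ t ∈ Set.Icc t₀ T, 0 ≤ u t →
      y' t ≤ -(μ * u t) + ρ + K * (ν - μ) * Real.exp (-(ν * (t - t₀)))) :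
    ∀ t ∈ Set.Icc t₀ T, y t ≤ Y * Real.exp (-(μ * (t - t₀))) + κ +
      K * (Real.exp (-(μ * (t - t₀))) - Real.exp (-(ν * (t - t₀)))) := by
  have hexp : ∀ c t : ℝ, HasDerivAt (fun t => Real.exp (-(c * (t - t₀))))
      (-(c * Real.exp (-(c * (t - t₀))))) t := by
    intro c t
    have h1 : HasDerivAt (fun t => -(c * (t - t₀))) (-(c * 1)) t :=
      (((hasDerivAt_id t).sub_const t₀).const_mul c).neg
    convert h1.exp using 1
    ring
  have hκη : η < κ := by
    have : 0 ≤ ρ / μ := by positivity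
    linarith
  have hκμ : μ * η + ρ < μ * κ := by
    have := mul_lt_mul_of_pos_left hκ hμ
    rwa [mul_add, mul_div_cancel₀ _ hμ.ne'] at this
  have hB : ∀ t : ℝ, HasDerivAt (fun t => Y * Real.exp (-(μ * (t - t₀))) + κ +
      K * (Real.exp (-(μ * (t - t₀))) - Real.exp (-(ν * (t - t₀)))))
      (Y * -(μ * Real.exp (-(μ * (t - t₀)))) +
      K * (-(μ * Real.exp (-(μ * (t - t₀)))) - -(ν * Real.exp (-(ν * (t - t₀)))))) t := fun t =>
    (((hexp μ t).const_mul Y).add_const κ).add (((hexp μ t).sub (hexp ν t)).const_mul K)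
  have hdiff : ∀ t, t₀ ≤ t → Real.exp (-(ν * (t - t₀))) ≤ Real.exp (-(μ * (t - t₀))) := by
    intro t ht
    apply Real.exp_le_exp.2
    have := mul_le_mul_of_nonneg_right hν (sub_nonneg.2 ht)
    linarith
  refine image_le_of_deriv_right_lt_deriv_boundary' (f' := y')
    (fun t ht => ((hy t ht).mono Set.Icc_subset_Ici_self).continuousWithinAt)
    (fun t ht => (hy t (Set.Ico_subset_Icc_self ht)).mono (Set.Ici_subset_Ici.2 ht.1))
    ?_ (fun t _ => (hB t).continuousAt.continuousWithinAt)
    (fun t _ => (hB t).hasDerivWithinAt) ?_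
  · simp only [sub_self, mul_zero, neg_zero, Real.exp_zero, mul_one, add_zero]
    linarith
  · intro t ht hyt
    have ht' := Set.Ico_subset_Icc_self ht
    have h1 := hη t ht'
    have h2 : 0 ≤ Y * Real.exp (-(μ * (t - t₀))) := by positivity
    have h3 : 0 ≤ K * (Real.exp (-(μ * (t - t₀))) - Real.exp (-(ν * (t - t₀)))) :=
      mul_nonneg hK (sub_nonneg.2 (hdiff t ht.1))
    have h4 := hu t ht' (by linarith)
    have h5 := mul_le_mul_of_nonneg_left h1 hμ.le
    rw [hyt] at h5
    nlinarith

/-- Two-sided version of `le_exp_barrier`. -/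
theorem abs_le_exp_barrier {y F r u : ℝ → ℝ} {t₀ T η μ ρ κ K ν : ℝ}
    (hμ : 0 < μ) (hK : 0 ≤ K) (hν : μ ≤ ν) (hκ : η + ρ / μ < κ) (hρ : 0 ≤ ρ)
    (hy : ∀ t ∈ Set.Icc t₀ T, HasDerivWithinAt y (-F t + r t) (Set.Ici t₀) t)
    (hη : ∀ t ∈ Set.Icc t₀ T, |y t - u t| ≤ η)
    (hFpos : ∀ t ∈ Set.Icc t₀ T, 0 ≤ u t → μ * u t ≤ F t)
    (hFneg : ∀ t ∈ Set.Icc t₀ T, u t ≤ 0 → F t ≤ μ * u t)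
    (hr : ∀ t ∈ Set.Icc t₀ T,
      |r t| ≤ ρ + K * (ν - μ) * Real.exp (-(ν * (t - t₀)))) :
    ∀ t ∈ Set.Icc t₀ T, |u t| ≤ |u t₀| * Real.exp (-(μ * (t - t₀))) + (2 * η + κ + K) := by
  intro t ht
  have ht₀ : t₀ ∈ Set.Icc t₀ T := ⟨le_rfl, ht.1.trans ht.2⟩
  have hη0 : 0 ≤ η := (abs_nonneg _).trans (hη t ht)
  have hup := le_exp_barrier (Y := |y t₀|) hμ hK hν hκ hρ (le_abs_self _) (abs_nonneg _) hy
    (u := u) (fun s hs => by linarith [(abs_le.1 (hη s hs)).2]) hη0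
    (fun s hs hus => by linarith [hFpos s hs hus, (abs_le.1 (hr s hs)).2]) t ht
  have hlo := le_exp_barrier (y := fun s => -y s) (Y := |y t₀|) hμ hK hν hκ hρ
    (neg_le_abs _) (abs_nonneg _) (fun s hs => (hy s hs).neg)
    (u := fun s => -u s) (fun s hs => by linarith [(abs_le.1 (hη s hs)).1]) hη0
    (fun s hs hus => by linarith [hFneg s hs (by linarith), (abs_le.1 (hr s hs)).1]) t ht
  have hyabs := abs_le.2 ⟨neg_le.1 hlo, hup⟩
  have h1 : |u t| ≤ |y t| + η := by
    have := abs_sub_abs_le_abs_sub (u t) (y t)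
    rw [abs_sub_comm] at this
    linarith [hη t ht]
  have h2 : |y t₀| ≤ |u t₀| + η := by
    linarith [abs_sub_abs_le_abs_sub (y t₀) (u t₀), hη t₀ ht₀]
  have hexp1 : Real.exp (-(μ * (t - t₀))) ≤ 1 :=
    Real.exp_le_one_iff.2 (neg_nonpos.2 (mul_nonneg hμ.le (sub_nonneg.2 ht.1)))
  have hexp0 := Real.exp_pos (-(μ * (t - t₀)))
  have hexp0' := Real.exp_pos (-(ν * (t - t₀)))
  have h3 := mul_le_mul_of_nonneg_right h2 hexp0.le
  have h4 := mul_le_mul_of_nonneg_left hexp1 hη0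
  have h5 : K * (Real.exp (-(μ * (t - t₀))) - Real.exp (-(ν * (t - t₀)))) ≤ K * 1 :=
    mul_le_mul_of_nonneg_left (by linarith) hK
  linarith

/-- First-order averaging by a near-identity transformation: for `ẋ = a cos θ + d` with phase
`θ = ω t + k j`, where `a² = α ω` and `j' = g x' + p`, the corrected state
`x - (a/ω) sin θ + (αk/(4ω)) sin (2θ) g` has the averaged velocity `-(αk/2) g` up to a remainder. -/
theorem hasDerivWithinAt_averaged {x j g : ℝ → ℝ} {s : Set ℝ} {t a α ω k x' d p q : ℝ}
    (hω : 0 < ω) (ha : a ^ 2 = α * ω)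
    (hx : HasDerivWithinAt x x' s t) (hj : HasDerivWithinAt j (g t * x' + p) s t)
    (hg : HasDerivWithinAt g q s t) (hd : x' = a * Real.cos (ω * t + k * j t) + d) :
    HasDerivWithinAt (fun t => x t - a / ω * Real.sin (ω * t + k * j t) +
        α * k / (4 * ω) * (Real.sin (2 * (ω * t + k * j t)) * g t))
      (-(α * k / 2 * g t) + (d - a / ω * k * (Real.cos (ω * t + k * j t) * (g t * d + p)) +
        α * k / (4 * ω) * (2 * k * (Real.cos (2 * (ω * t + k * j t)) * (g t * x' + p)) * g t +
          Real.sin (2 * (ω * t + k * j t)) * q))) s t := by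
  have hθ : HasDerivWithinAt (fun t => ω * t + k * j t) (ω * 1 + k * (g t * x' + p)) s t :=
    ((hasDerivWithinAt_id t s).const_mul ω).add (hj.const_mul k)
  have h := (hx.sub (hθ.sin.const_mul (a / ω))).add
    (((hθ.const_mul 2).sin.mul hg).const_mul (α * k / (4 * ω)))
  refine h.congr_deriv ?_
  have hc : Real.cos (2 * (ω * t + k * j t)) = 2 * Real.cos (ω * t + k * j t) ^ 2 - 1 :=
    Real.cos_two_mul _
  have ha' : a / ω * a = α := by
    rw [div_mul_eq_mul_div, ← sq, ha]; field_simp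
  have haω : a / ω * ω = a := by field_simp
  have hαω : α * k / (4 * ω) * ω = α * k / 4 := by field_simp
  generalize Real.sin (2 * (ω * t + k * j t)) = S at *
  generalize Real.cos (2 * (ω * t + k * j t)) = C at *
  generalize Real.cos (ω * t + k * j t) = c at *
  generalize α * k / (4 * ω) = z at *
  generalize a / ω = b at *
  subst hd
  subst hc
  linear_combination (-c) * haω + (2 * (2 * c ^ 2 - 1) * g t) * hαω - k * c ^ 2 * g t * ha'

/-- Size of the remainder in `hasDerivWithinAt_averaged`. -/
theorem abs_averaged_remainder_le {b k z c C S g x' d p q G P Q X : ℝ} (hb : 0 ≤ b)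
    (hk : 0 ≤ k) (hz : 0 ≤ z) (hc : |c| ≤ 1) (hC : |C| ≤ 1) (hS : |S| ≤ 1) (hg : |g| ≤ G)
    (hp : |p| ≤ P) (hq : |q| ≤ Q) (hX : |x'| ≤ X) :
    |d - b * k * (c * (g * d + p)) + z * (2 * k * (C * (g * x' + p)) * g + S * q)| ≤
      |d| * (1 + b * k * G) + b * k * P + z * (2 * k * (G * X + P) * G + Q) := by
  have hG : 0 ≤ G := (abs_nonneg _).trans hg
  have hP : 0 ≤ P := (abs_nonneg _).trans hp
  have hX0 : 0 ≤ X := (abs_nonneg _).trans hX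
  have h1 : |c * (g * d + p)| ≤ 1 * (G * |d| + P) := by
    rw [abs_mul]
    refine mul_le_mul hc ((abs_add_le _ _).trans ?_) (abs_nonneg _) zero_le_one
    rw [abs_mul]
    gcongr
  have h2 : |C * (g * x' + p)| ≤ 1 * (G * X + P) := by
    rw [abs_mul]
    refine mul_le_mul hC ((abs_add_le _ _).trans ?_) (abs_nonneg _) zero_le_one
    rw [abs_mul]
    gcongr
  have h3 : |2 * k * (C * (g * x' + p)) * g + S * q| ≤ 2 * k * (G * X + P) * G + Q := by
    refine (abs_add_le _ _).trans (add_le_add ?_ ?_)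
    · rw [abs_mul, abs_mul, abs_of_nonneg (by positivity : (0 : ℝ) ≤ 2 * k)]
      rw [one_mul] at h2
      gcongr
    · rw [abs_mul]
      calc |S| * |q| ≤ 1 * Q := mul_le_mul hS hq (abs_nonneg _) zero_le_one
        _ = Q := one_mul _
  calc _ ≤ |d - b * k * (c * (g * d + p))| +
        |z * (2 * k * (C * (g * x' + p)) * g + S * q)| := abs_add_le _ _
    _ ≤ (|d| + |b * k * (c * (g * d + p))|) +
        |z * (2 * k * (C * (g * x' + p)) * g + S * q)| := by
      gcongr
      exact abs_sub _ _
    _ = (|d| + b * k * |c * (g * d + p)|) +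
        z * |2 * k * (C * (g * x' + p)) * g + S * q| := by
      rw [abs_mul (b * k), abs_mul z, abs_of_nonneg hz, abs_of_nonneg (mul_nonneg hb hk)]
    _ ≤ (|d| + b * k * (1 * (G * |d| + P))) + z * (2 * k * (G * X + P) * G + Q) := by
      gcongr
    _ = _ := by ring

/-- The partial derivatives of a `C^{n+1}` function of two real variables are `C^n`. -/
theorem ContDiff.exists_partials {F : ℝ × ℝ → ℝ} {n : ℕ} (hF : ContDiff ℝ (n + 1) F) :
    ∃ F₁ F₂ : ℝ × ℝ → ℝ, ContDiff ℝ n F₁ ∧ ContDiff ℝ n F₂ ∧ ∀ p,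
      HasFDerivAt F (F₁ p • ContinuousLinearMap.fst ℝ ℝ ℝ + F₂ p • ContinuousLinearMap.snd ℝ ℝ ℝ)
        p := by
  have hd : ContDiff ℝ n (fderiv ℝ F) := hF.fderiv_right le_rfl
  refine ⟨fun p => fderiv ℝ F p (1, 0), fun p => fderiv ℝ F p (0, 1), hd.clm_apply contDiff_const,
    hd.clm_apply contDiff_const, fun p => ?_⟩
  have h := (hF.differentiable (by simp) p).hasFDerivAt
  refine h.congr_fderiv ?_
  ext <;> simp

theorem HasFDerivAt.hasDerivWithinAt_comp_pair {F : ℝ × ℝ → ℝ} {x₁ x₂ : ℝ → ℝ}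
    {a b x₁' x₂' t : ℝ} {s : Set ℝ}
    (hF : HasFDerivAt F (a • ContinuousLinearMap.fst ℝ ℝ ℝ + b • ContinuousLinearMap.snd ℝ ℝ ℝ)
      (x₁ t, x₂ t))
    (h₁ : HasDerivWithinAt x₁ x₁' s t) (h₂ : HasDerivWithinAt x₂ x₂' s t) :
    HasDerivWithinAt (fun t => F (x₁ t, x₂ t)) (a * x₁' + b * x₂') s t := by
  have h := hF.comp_hasDerivWithinAt t (h₁.prodMk h₂)
  simpa using! h

theorem HasFDerivAt.hasDerivAt_snd {F : ℝ × ℝ → ℝ} {a b x₁ x₂ : ℝ}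
    (hF : HasFDerivAt F (a • ContinuousLinearMap.fst ℝ ℝ ℝ + b • ContinuousLinearMap.snd ℝ ℝ ℝ)
      (x₁, x₂)) :
    HasDerivAt (fun y => F (x₁, y)) b x₂ := by
  have h := HasFDerivAt.hasDerivWithinAt_comp_pair (s := Set.univ) (x₁ := fun _ => x₁)
    (x₂ := fun y => y) (t := x₂) hF (hasDerivWithinAt_const _ _ _) (hasDerivWithinAt_id _ _)
  rw [hasDerivWithinAt_univ] at h
  simpa using! h

/-- The regularity and convexity data of a nested pair of costs: `J'` and `J''` are the derivatives
of the leader's cost reduced along the follower's response `h`, and `F₁`, `F₂`, `F₂₁`, `F₂₂` are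
partial derivatives of the follower's cost. -/
structure IsNestedCost (JL JF : ℝ → ℝ → ℝ) (h h' J' J'' : ℝ → ℝ)
    (F₁ F₂ F₂₁ F₂₂ : ℝ × ℝ → ℝ) (x₁s m₁ m₂ : ℝ) : Prop where
  contDiff_JL : ContDiff ℝ 1 fun p : ℝ × ℝ => JL p.1 p.2
  hasDerivAt_h : ∀ x, HasDerivAt h (h' x) x
  hasDerivAt_J : ∀ x, HasDerivAt (fun x => JL x (h x)) (J' x) x
  hasDerivAt_J' : ∀ x, HasDerivAt J' (J'' x) x
  hasFDerivAt_F : ∀ p, HasFDerivAt (fun p : ℝ × ℝ => JF p.1 p.2)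
    (F₁ p • ContinuousLinearMap.fst ℝ ℝ ℝ + F₂ p • ContinuousLinearMap.snd ℝ ℝ ℝ) p
  hasFDerivAt_F₂ : ∀ p, HasFDerivAt F₂
    (F₂₁ p • ContinuousLinearMap.fst ℝ ℝ ℝ + F₂₂ p • ContinuousLinearMap.snd ℝ ℝ ℝ) p
  continuous_h' : Continuous h'
  continuous_J'' : Continuous J''
  continuous_F₁ : Continuous F₁
  continuous_F₂₁ : Continuous F₂₁
  continuous_F₂₂ : Continuous F₂₂
  F₂_root : ∀ x, F₂ (x, h x) = 0
  le_F₂₂ : ∀ p, m₂ ≤ F₂₂ p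
  J'_root : J' x₁s = 0
  le_J'' : ∀ x, m₁ ≤ J'' x

/-- The response of the follower is `C²` because `h' = -∂₁₂J_F / ∂₂₂J_F` along its graph. -/
theorem exists_isNestedCost {JL JF : ℝ → ℝ → ℝ} {h : ℝ → ℝ} {x₁s m₁ m₂ : ℝ}
    (hJL : ContDiff ℝ 2 (fun p : ℝ × ℝ => JL p.1 p.2))
    (hJF : ContDiff ℝ 3 (fun p : ℝ × ℝ => JF p.1 p.2))
    (hroot : ∀ x₁ x₂ : ℝ, deriv (JF x₁) x₂ = 0 ↔ x₂ = h x₁)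
    (hh : ContDiff ℝ 1 h)
    (hm₂ : 0 < m₂) (hconvF : ∀ x₁ x₂ : ℝ, m₂ ≤ iteratedDeriv 2 (JF x₁) x₂)
    (hcrit : deriv (fun x₁ => JL x₁ (h x₁)) x₁s = 0)
    (hconvL : ∀ x₁ : ℝ, m₁ ≤ iteratedDeriv 2 (fun x => JL x (h x)) x₁) :
    ∃ (h' J' J'' : ℝ → ℝ) (F₁ F₂ F₂₁ F₂₂ : ℝ × ℝ → ℝ),
      IsNestedCost JL JF h h' J' J'' F₁ F₂ F₂₁ F₂₂ x₁s m₁ m₂ := by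
  obtain ⟨F₁, F₂, hF₁, hF₂, hF⟩ := ContDiff.exists_partials (n := 2)
    (by convert hJF using 1; norm_num)
  obtain ⟨F₂₁, F₂₂, hF₂₁, hF₂₂, hF2⟩ := ContDiff.exists_partials (n := 1)
    (by convert hF₂ using 1; norm_num)
  have hderiv : ∀ x₁, deriv (JF x₁) = fun x₂ => F₂ (x₁, x₂) := fun x₁ =>
    funext fun x₂ => (hF (x₁, x₂)).hasDerivAt_snd.deriv
  have hF₂₂_ge : ∀ p : ℝ × ℝ, m₂ ≤ F₂₂ p := by
    intro p
    have h1 := hconvF p.1 p.2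
    rw [iteratedDeriv_succ, iteratedDeriv_one, hderiv, (hF2 p).hasDerivAt_snd.deriv] at h1
    exact h1
  have hF₂root : ∀ x, F₂ (x, h x) = 0 := by
    intro x
    have h1 := (hroot x (h x)).2 rfl
    rwa [hderiv] at h1
  have hhd : Differentiable ℝ h := hh.differentiable (by simp)
  have hderivh : deriv h = fun x => -(F₂₁ (x, h x)) / F₂₂ (x, h x) := by
    funext x
    have h1 := HasFDerivAt.hasDerivWithinAt_comp_pair (s := Set.univ) (x₁ := fun x => x) (x₂ := h)
      (t := x) (hF2 _) (hasDerivWithinAt_id _ _) (hhd x).hasDerivAt.hasDerivWithinAt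
    rw [hasDerivWithinAt_univ] at h1
    simp only [hF₂root] at h1
    have h2 := h1.unique (hasDerivAt_const x (0 : ℝ))
    have h3 : F₂₂ (x, h x) ≠ 0 := (hm₂.trans_le (hF₂₂_ge _)).ne'
    field_simp
    linarith
  have hh2 : ContDiff ℝ 2 h := by
    rw [show (2 : WithTop ℕ∞) = 1 + 1 by norm_num, contDiff_succ_iff_deriv]
    refine ⟨hhd, by simp, ?_⟩
    rw [hderivh]
    have hpair : ContDiff ℝ 1 fun x => (x, h x) := contDiff_id.prodMk hh
    exact ((hF₂₁.comp hpair).neg).div (hF₂₂.comp hpair)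
      fun x => (hm₂.trans_le (hF₂₂_ge _)).ne'
  have hJ : ContDiff ℝ 2 fun x => JL x (h x) := hJL.comp (contDiff_id.prodMk hh2)
  have hJ1 : ContDiff ℝ 1 (deriv fun x => JL x (h x)) := by
    rw [show (2 : WithTop ℕ∞) = 1 + 1 by norm_num, contDiff_succ_iff_deriv] at hJ
    exact hJ.2.2
  refine ⟨deriv h, deriv fun x => JL x (h x), deriv (deriv fun x => JL x (h x)), F₁, F₂, F₂₁, F₂₂,
    ?_⟩
  exact
    { contDiff_JL := hJL.of_le (by norm_num)
      hasDerivAt_h := fun x => (hhd x).hasDerivAt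
      hasDerivAt_J := fun x => (hJ.differentiable (by simp) x).hasDerivAt
      hasDerivAt_J' := fun x => (hJ1.differentiable (by simp) x).hasDerivAt
      hasFDerivAt_F := hF
      hasFDerivAt_F₂ := hF2
      continuous_h' := hh.continuous_deriv le_rfl
      continuous_J'' := hJ1.continuous_deriv le_rfl
      continuous_F₁ := hF₁.continuous
      continuous_F₂₁ := hF₂₁.continuous
      continuous_F₂₂ := hF₂₂.continuous
      F₂_root := hF₂root
      le_F₂₂ := hF₂₂_ge
      J'_root := hcrit
      le_J'' := fun x => by
        have h1 := hconvL x
        rwa [iteratedDeriv_succ, iteratedDeriv_one] at h1 }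

namespace IsNestedCost

variable {JL JF : ℝ → ℝ → ℝ} {h h' J' J'' : ℝ → ℝ} {F₁ F₂ F₂₁ F₂₂ : ℝ × ℝ → ℝ} {x₁s m₁ m₂ : ℝ}

theorem le_F₂ (H : IsNestedCost JL JF h h' J' J'' F₁ F₂ F₂₁ F₂₂ x₁s m₁ m₂) {x₁ x₂ : ℝ}
    (hx : 0 ≤ x₂ - h x₁) : m₂ * (x₂ - h x₁) ≤ F₂ (x₁, x₂) := by
  have hd : ∀ y, HasDerivAt (fun y => F₂ (x₁, y)) (F₂₂ (x₁, y)) y :=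
    fun y => (H.hasFDerivAt_F₂ _).hasDerivAt_snd
  have h1 := mul_sub_le_image_sub_of_le_deriv (C := m₂) (fun y => (hd y).differentiableAt)
    (fun y => by rw [(hd y).deriv]; exact H.le_F₂₂ _) (sub_nonneg.1 hx)
  simpa [H.F₂_root] using h1

theorem F₂_le (H : IsNestedCost JL JF h h' J' J'' F₁ F₂ F₂₁ F₂₂ x₁s m₁ m₂) {x₁ x₂ : ℝ}
    (hx : x₂ - h x₁ ≤ 0) : F₂ (x₁, x₂) ≤ m₂ * (x₂ - h x₁) := by
  have hd : ∀ y, HasDerivAt (fun y => F₂ (x₁, y)) (F₂₂ (x₁, y)) y :=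
    fun y => (H.hasFDerivAt_F₂ _).hasDerivAt_snd
  have h1 := mul_sub_le_image_sub_of_le_deriv (C := m₂) (fun y => (hd y).differentiableAt)
    (fun y => by rw [(hd y).deriv]; exact H.le_F₂₂ _) (sub_nonpos.1 hx)
  simp only [H.F₂_root] at h1
  linarith

theorem le_J' (H : IsNestedCost JL JF h h' J' J'' F₁ F₂ F₂₁ F₂₂ x₁s m₁ m₂) {x : ℝ}
    (hx : 0 ≤ x - x₁s) : m₁ * (x - x₁s) ≤ J' x := by
  have h1 := mul_sub_le_image_sub_of_le_deriv (C := m₁)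
    (fun y => (H.hasDerivAt_J' y).differentiableAt)
    (fun y => by rw [(H.hasDerivAt_J' y).deriv]; exact H.le_J'' _) (sub_nonneg.1 hx)
  simpa [H.J'_root] using h1

theorem J'_le (H : IsNestedCost JL JF h h' J' J'' F₁ F₂ F₂₁ F₂₂ x₁s m₁ m₂) {x : ℝ}
    (hx : x - x₁s ≤ 0) : J' x ≤ m₁ * (x - x₁s) := by
  have h1 := mul_sub_le_image_sub_of_le_deriv (C := m₁)
    (fun y => (H.hasDerivAt_J' y).differentiableAt)
    (fun y => by rw [(H.hasDerivAt_J' y).deriv]; exact H.le_J'' _) (sub_nonpos.1 hx)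
  simp only [H.J'_root] at h1
  linarith

end IsNestedCost

/-- A common bound `M` at a point `(x₁, x₂)` for the derivatives of the nested costs. -/
structure IsNestedBound (JL : ℝ → ℝ → ℝ) (h h' J' J'' : ℝ → ℝ)
    (F₁ F₂ F₂₁ F₂₂ : ℝ × ℝ → ℝ) (M x₁ x₂ : ℝ) : Prop where
  abs_h' : |h' x₁| ≤ M
  abs_J' : |J' x₁| ≤ M
  abs_J'' : |J'' x₁| ≤ M
  abs_F₁ : |F₁ (x₁, x₂)| ≤ M
  abs_F₂ : |F₂ (x₁, x₂)| ≤ M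
  abs_F₂₁ : |F₂₁ (x₁, x₂)| ≤ M
  abs_F₂₂ : |F₂₂ (x₁, x₂)| ≤ M
  abs_JL_sub : |JL x₁ x₂ - JL x₁ (h x₁)| ≤ M * |x₂ - h x₁|

theorem IsNestedCost.exists_bound {JL JF : ℝ → ℝ → ℝ} {h h' J' J'' : ℝ → ℝ}
    {F₁ F₂ F₂₁ F₂₂ : ℝ × ℝ → ℝ} {x₁s m₁ m₂ : ℝ}
    (H : IsNestedCost JL JF h h' J' J'' F₁ F₂ F₂₁ F₂₂ x₁s m₁ m₂) {R : ℝ} (hR : 0 ≤ R) :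
    ∃ M, 0 < M ∧ ∀ x₁ x₂, |x₁ - x₁s| ≤ R → |x₂ - h x₁| ≤ R →
      IsNestedBound JL h h' J' J'' F₁ F₂ F₂₁ F₂₂ M x₁ x₂ := by
  have hch : Continuous h :=
    continuous_iff_continuousAt.2 fun x => (H.hasDerivAt_h x).continuousAt
  have hcJ' : Continuous J' :=
    continuous_iff_continuousAt.2 fun x => (H.hasDerivAt_J' x).continuousAt
  have hcF₂ : Continuous F₂ :=
    continuous_iff_continuousAt.2 fun x => (H.hasFDerivAt_F₂ x).continuousAt
  have := H.continuous_h'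
  have := H.continuous_J''
  have := H.continuous_F₁
  have := H.continuous_F₂₁
  have := H.continuous_F₂₂
  let Φ : ℝ × ℝ → ℝ × ℝ := fun q => (q.1, h q.1 + q.2)
  have hΦ : Continuous Φ := by fun_prop
  let D : Set (ℝ × ℝ) := Φ '' (Metric.closedBall x₁s R ×ˢ Metric.closedBall 0 R)
  have hD : IsCompact D :=
    ((isCompact_closedBall x₁s R).prod (isCompact_closedBall 0 R)).image hΦ
  have hmem : ∀ x₁ x₂, |x₁ - x₁s| ≤ R → |x₂ - h x₁| ≤ R → (x₁, x₂) ∈ D := by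
    intro x₁ x₂ h1 h2
    refine ⟨(x₁, x₂ - h x₁), ⟨?_, ?_⟩, by simp [Φ]⟩
    · simpa [Real.dist_eq] using h1
    · simpa using h2
  obtain ⟨C, hC⟩ := hD.exists_bound_of_continuousOn (f := fun p : ℝ × ℝ =>
    |h' p.1| + |J' p.1| + |J'' p.1| + |F₁ p| + |F₂ p| + |F₂₁ p| + |F₂₂ p|)
    (Continuous.continuousOn (by fun_prop))
  obtain ⟨K, hK⟩ := (H.contDiff_JL.locallyLipschitz.locallyLipschitzOn
    (s := D)).exists_lipschitzOnWith_of_compact hD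
  refine ⟨|C| + K + 1, by positivity, fun x₁ x₂ h1 h2 => ?_⟩
  have hp := hmem x₁ x₂ h1 h2
  have hp' := hmem x₁ (h x₁) h1 (by simpa using hR)
  have hb := (le_abs_self _).trans ((hC _ hp).trans (le_abs_self C))
  have hK0 : (0 : ℝ) ≤ K := K.2
  have e1 := abs_nonneg (h' x₁)
  have e2 := abs_nonneg (J' x₁)
  have e3 := abs_nonneg (J'' x₁)
  have e4 := abs_nonneg (F₁ (x₁, x₂))
  have e5 := abs_nonneg (F₂ (x₁, x₂))
  have e6 := abs_nonneg (F₂₁ (x₁, x₂))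
  have e7 := abs_nonneg (F₂₂ (x₁, x₂))
  refine ⟨by linarith, by linarith, by linarith, by linarith, by linarith, by linarith,
    by linarith, ?_⟩
  have hl := hK.dist_le_mul _ hp _ hp'
  simp only [Real.dist_eq, Prod.dist_eq, sub_self, abs_zero] at hl
  rw [max_eq_right (abs_nonneg _)] at hl
  refine hl.trans (mul_le_mul_of_nonneg_right ?_ (abs_nonneg _))
  linarith [abs_nonneg C]

/-- A `C¹` function has a class `𝒦` modulus of continuity at any point. -/
theorem ContDiff.exists_strictMono_modulus {h : ℝ → ℝ} (hh : ContDiff ℝ 1 h) (c : ℝ) :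
    ∃ γ : ℝ → ℝ, Continuous γ ∧ StrictMono γ ∧ γ 0 = 0 ∧ ∀ u, |h u - h c| ≤ γ |u - c| := by
  have hcd : Continuous (deriv h) := hh.continuous_deriv le_rfl
  have hd : ∀ x, HasDerivAt h (deriv h x) x := fun x => (hh.differentiable (by simp) x).hasDerivAt
  let φ : ℝ → ℝ := fun s => 1 + |deriv h (c + s)| + |deriv h (c - s)|
  have hφ : Continuous φ := by fun_prop
  have hγ : ∀ r, HasDerivAt (fun r => ∫ s in (0 : ℝ)..r, φ s) (φ r) r := fun r =>
    intervalIntegral.integral_hasDerivAt_right (hφ.intervalIntegrable _ _)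
      (hφ.stronglyMeasurableAtFilter _ _) hφ.continuousAt
  have hbound : ∀ ψ ψ' : ℝ → ℝ, (∀ s, HasDerivAt ψ (ψ' s) s) → (∀ s, |ψ' s| ≤ φ s) → ψ 0 = 0 →
      ∀ u, 0 ≤ u → |ψ u| ≤ ∫ s in (0 : ℝ)..u, φ s := by
    intro ψ ψ' hψ hψ' hψ0 u hu
    exact image_norm_le_of_norm_deriv_right_le_deriv_boundary (a := 0) (b := u) (f := ψ) (f' := ψ')
      (fun s _ => (hψ s).continuousAt.continuousWithinAt)
      (fun s _ => (hψ s).hasDerivWithinAt) (by simp [hψ0]) hγ (fun s _ => hψ' s)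
      ⟨hu, le_rfl⟩
  refine ⟨fun r => ∫ s in (0 : ℝ)..r, φ s,
    continuous_iff_continuousAt.2 fun r => (hγ r).continuousAt,
    strictMono_of_deriv_pos fun r => ?_, by simp, fun u => ?_⟩
  · rw [(hγ r).deriv]
    positivity
  · rcases le_total c u with hu | hu
    · have h1 := hbound (fun s => h (c + s) - h c) (fun s => deriv h (c + s))
        (fun s => ((hd (c + s)).comp_const_add c s).sub_const _)
        (fun s => by
          change _ ≤ 1 + |deriv h (c + s)| + |deriv h (c - s)|
          linarith [abs_nonneg (deriv h (c - s))]) (by simp) |u - c| (abs_nonneg _)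
      rw [abs_of_nonneg (sub_nonneg.2 hu)] at h1 ⊢
      simpa using h1
    · have h1 := hbound (fun s => h (c - s) - h c) (fun s => -deriv h (c - s))
        (fun s => ((hd (c - s)).comp_const_sub c s).sub_const _)
        (fun s => by
          change _ ≤ 1 + |deriv h (c + s)| + |deriv h (c - s)|
          rw [abs_neg]
          linarith [abs_nonneg (deriv h (c + s))]) (by simp) |u - c| (abs_nonneg _)
      rw [abs_of_nonpos (sub_nonpos.2 hu)] at h1 ⊢
      simpa using h1

/-- The `𝒦ℒ` estimate attached to a modulus `γ` and a rate `c`. -/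
theorem isClassKL_of_modulus {γ : ℝ → ℝ} (hγc : Continuous γ) (hγm : StrictMono γ)
    (hγ0 : γ 0 = 0) {c : ℝ} (hc : 0 < c) :
    IsClassKL fun r s => r * Real.exp (-(c * s)) + (r + γ r) * Real.exp (-s) +
      γ (2 * (r * Real.exp (-(c * s)))) := by
  have hγnn : ∀ r, 0 ≤ r → 0 ≤ γ r := fun r hr => hγ0 ▸ hγm.monotone hr
  have hanti : ∀ d : ℝ, 0 < d → Antitone fun s : ℝ => Real.exp (-(d * s)) := fun d hd s t hst =>
    Real.exp_le_exp.2 (neg_le_neg (mul_le_mul_of_nonneg_left hst hd.le))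
  refine ⟨Continuous.continuousOn ?_, fun s hs => ⟨Continuous.continuousOn ?_, ?_, ?_⟩,
    fun r hr => ?_, fun r hr => ?_⟩
  · unfold Function.uncurry
    fun_prop
  · fun_prop
  · intro a _ b _ hab
    have h1 : a * Real.exp (-(c * s)) < b * Real.exp (-(c * s)) :=
      mul_lt_mul_of_pos_right hab (Real.exp_pos _)
    have h2 : (a + γ a) * Real.exp (-s) < (b + γ b) * Real.exp (-s) :=
      mul_lt_mul_of_pos_right (add_lt_add hab (hγm hab)) (Real.exp_pos _)
    have h3 : γ (2 * (a * Real.exp (-(c * s)))) < γ (2 * (b * Real.exp (-(c * s)))) :=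
      hγm (by linarith)
    dsimp only
    linarith
  · simp [hγ0]
  · intro s _ t _ hst
    have h1 : r * Real.exp (-(c * t)) ≤ r * Real.exp (-(c * s)) :=
      mul_le_mul_of_nonneg_left (hanti c hc hst) hr
    have h2 : (r + γ r) * Real.exp (-t) ≤ (r + γ r) * Real.exp (-s) :=
      mul_le_mul_of_nonneg_left (Real.exp_le_exp.2 (neg_le_neg hst)) (add_nonneg hr (hγnn r hr))
    have h3 : γ (2 * (r * Real.exp (-(c * t)))) ≤ γ (2 * (r * Real.exp (-(c * s)))) :=
      hγm.monotone (by linarith)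
    dsimp only
    linarith
  · have h1 : Filter.Tendsto (fun s : ℝ => Real.exp (-(c * s))) Filter.atTop (nhds 0) :=
      Real.tendsto_exp_neg_atTop_nhds_zero.comp (Filter.tendsto_id.const_mul_atTop hc)
    have h2 := h1.const_mul r
    have h3 := Real.tendsto_exp_neg_atTop_nhds_zero.const_mul (r + γ r)
    have h4 := (hγc.tendsto (2 * (r * 0))).comp (h2.const_mul 2)
    simpa [hγ0] using! (h2.add h3).add h4

/-- Size of the near-identity transformation in `hasDerivWithinAt_averaged`, if `|g| ≤ G`. -/
noncomputable def avgShift (α k ω G : ℝ) : ℝ :=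
  √(α * ω) / ω + α * k / (4 * ω) * G

/-- Size of the part of the remainder in `hasDerivWithinAt_averaged` that does not involve `d`, if
`|g| ≤ G`, `|p| ≤ P`, `|q| ≤ Q` and `|x'| ≤ √(α ω)`. -/
noncomputable def avgDrift (α k ω G P Q : ℝ) : ℝ :=
  √(α * ω) / ω * k * P + α * k / (4 * ω) * (2 * k * (G * √(α * ω) + P) * G + Q)

theorem avgDrift_nonneg {α k ω G P Q : ℝ} (hα : 0 < α) (hk : 0 < k) (hω : 0 < ω) (hG : 0 ≤ G)
    (hP : 0 ≤ P) (hQ : 0 ≤ Q) : 0 ≤ avgDrift α k ω G P Q := by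
  unfold avgDrift
  positivity

theorem abs_averaged_shift_le {α k ω G x g θ : ℝ} (hα : 0 < α) (hk : 0 < k) (hω : 0 < ω)
    (hg : |g| ≤ G) :
    |x - √(α * ω) / ω * Real.sin θ + α * k / (4 * ω) * (Real.sin (2 * θ) * g) - x| ≤
      avgShift α k ω G := by
  have h1 : |√(α * ω) / ω * Real.sin θ| ≤ √(α * ω) / ω := by
    rw [abs_mul, abs_of_nonneg (by positivity)]
    exact mul_le_of_le_one_right (by positivity) (Real.abs_sin_le_one _)
  have h2 : |α * k / (4 * ω) * (Real.sin (2 * θ) * g)| ≤ α * k / (4 * ω) * G := by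
    rw [abs_mul, abs_of_nonneg (by positivity), abs_mul]
    gcongr
    calc |Real.sin (2 * θ)| * |g| ≤ 1 * G :=
          mul_le_mul (Real.abs_sin_le_one _) hg (abs_nonneg _) zero_le_one
      _ = G := one_mul _
  rw [abs_le] at h1 h2 ⊢
  unfold avgShift
  constructor <;> linarith [h1.1, h1.2, h2.1, h2.2]

theorem abs_mul_cos_le {a : ℝ} (ha : 0 ≤ a) (θ : ℝ) : |a * Real.cos θ| ≤ a := by
  rw [abs_mul, abs_of_nonneg ha]
  exact mul_le_of_le_one_right ha (Real.abs_cos_le_one _)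

section Trajectory

variable {JL JF : ℝ → ℝ → ℝ} {h h' J' J'' : ℝ → ℝ} {F₁ F₂ F₂₁ F₂₂ : ℝ × ℝ → ℝ} {x₁s m₁ m₂ : ℝ}
  {x₁ x₂ : ℝ → ℝ} {α₁ k₁ ω₁ α₂ k₂ ω₂ t₀ T M κ : ℝ}

/-- The follower's state contracts to its response at rate `α₂k₂m₂/2`. -/
theorem IsNestedCost.follower_bound
    (H : IsNestedCost JL JF h h' J' J'' F₁ F₂ F₂₁ F₂₂ x₁s m₁ m₂) (hm₂ : 0 < m₂)
    (hα₂ : 0 < α₂) (hk₂ : 0 < k₂) (hω₂ : 0 < ω₂)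
    (hx₁ : ∀ t ∈ Set.Ici t₀, HasDerivWithinAt x₁
      (√(α₁ * ω₁) * Real.cos (ω₁ * t + k₁ * JL (x₁ t) (x₂ t))) (Set.Ici t₀) t)
    (hx₂ : ∀ t ∈ Set.Ici t₀, HasDerivWithinAt x₂
      (√(α₂ * ω₂) * Real.cos (ω₂ * t + k₂ * JF (x₁ t) (x₂ t))) (Set.Ici t₀) t)
    (hM0 : 0 < M)
    (hM : ∀ t ∈ Set.Icc t₀ T, IsNestedBound JL h h' J' J'' F₁ F₂ F₂₁ F₂₂ M (x₁ t) (x₂ t))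
    (hκ : avgShift α₂ k₂ ω₂ M +
      (avgDrift α₂ k₂ ω₂ M (M * √(α₁ * ω₁)) (M * √(α₁ * ω₁) + M * √(α₂ * ω₂)) +
        M * √(α₁ * ω₁)) / (α₂ * k₂ / 2 * m₂) < κ) :
    ∀ t ∈ Set.Icc t₀ T, |x₂ t - h (x₁ t)| ≤
      |x₂ t₀ - h (x₁ t₀)| * Real.exp (-(α₂ * k₂ / 2 * m₂ * (t - t₀))) +
        (2 * avgShift α₂ k₂ ω₂ M + κ) := by
  set v₁ : ℝ → ℝ := fun t => √(α₁ * ω₁) * Real.cos (ω₁ * t + k₁ * JL (x₁ t) (x₂ t)) with hv₁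
  set v₂ : ℝ → ℝ := fun t => √(α₂ * ω₂) * Real.cos (ω₂ * t + k₂ * JF (x₁ t) (x₂ t)) with hv₂
  have hv₁_le : ∀ t, |v₁ t| ≤ √(α₁ * ω₁) := fun t => abs_mul_cos_le (Real.sqrt_nonneg _) _
  have hv₂_le : ∀ t, |v₂ t| ≤ √(α₂ * ω₂) := fun t => abs_mul_cos_le (Real.sqrt_nonneg _) _
  set θ : ℝ → ℝ := fun t => ω₂ * t + k₂ * JF (x₁ t) (x₂ t) with hθ
  let r : ℝ → ℝ := fun t =>
    (0 - √(α₂ * ω₂) / ω₂ * k₂ * (Real.cos (θ t) *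
        (F₂ (x₁ t, x₂ t) * 0 + F₁ (x₁ t, x₂ t) * v₁ t)) +
      α₂ * k₂ / (4 * ω₂) * (2 * k₂ * (Real.cos (2 * θ t) *
        (F₂ (x₁ t, x₂ t) * v₂ t + F₁ (x₁ t, x₂ t) * v₁ t)) * F₂ (x₁ t, x₂ t) +
        Real.sin (2 * θ t) * (F₂₁ (x₁ t, x₂ t) * v₁ t + F₂₂ (x₁ t, x₂ t) * v₂ t))) -
      h' (x₁ t) * v₁ t
  have hμ : 0 < α₂ * k₂ / 2 * m₂ := by positivity
  have hρ : 0 ≤ avgDrift α₂ k₂ ω₂ M (M * √(α₁ * ω₁)) (M * √(α₁ * ω₁) + M * √(α₂ * ω₂)) +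
      M * √(α₁ * ω₁) :=
    add_nonneg (avgDrift_nonneg hα₂ hk₂ hω₂ hM0.le (by positivity) (by positivity))
      (by positivity)
  have key := abs_le_exp_barrier (t₀ := t₀) (T := T) (K := 0) (ν := α₂ * k₂ / 2 * m₂)
    (y := fun t => x₂ t - √(α₂ * ω₂) / ω₂ * Real.sin (θ t) +
      α₂ * k₂ / (4 * ω₂) * (Real.sin (2 * θ t) * F₂ (x₁ t, x₂ t)) - h (x₁ t))
    (F := fun t => α₂ * k₂ / 2 * F₂ (x₁ t, x₂ t)) (r := r)
    (u := fun t => x₂ t - h (x₁ t)) hμ le_rfl le_rfl hκ hρ ?_ ?_ ?_ ?_ ?_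
  · simpa using key
  · intro t ht
    have ht' : t ∈ Set.Ici t₀ := ht.1
    have hj := HasFDerivAt.hasDerivWithinAt_comp_pair (H.hasFDerivAt_F (x₁ t, x₂ t))
      (hx₁ t ht') (hx₂ t ht')
    have hg := HasFDerivAt.hasDerivWithinAt_comp_pair (H.hasFDerivAt_F₂ (x₁ t, x₂ t))
      (hx₁ t ht') (hx₂ t ht')
    have hw := hasDerivWithinAt_averaged (a := √(α₂ * ω₂)) (α := α₂) (ω := ω₂) (k := k₂)
      (j := fun t => JF (x₁ t) (x₂ t)) (g := fun t => F₂ (x₁ t, x₂ t)) (d := 0)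
      (p := F₁ (x₁ t, x₂ t) * v₁ t) hω₂ (Real.sq_sqrt (by positivity)) (hx₂ t ht')
      (hj.congr_deriv (by ring)) hg (by simp)
    refine (hw.sub ((H.hasDerivAt_h (x₁ t)).comp_hasDerivWithinAt t (hx₁ t ht'))).congr_deriv ?_
    simp only [r, hv₁, hv₂, hθ]
    ring
  · intro t ht
    have h1 := abs_averaged_shift_le (x := x₂ t) (θ := θ t) hα₂ hk₂ hω₂ (hM t ht).abs_F₂
    convert h1 using 2
    ring
  · intro t _ hu
    have h1 := mul_le_mul_of_nonneg_left (H.le_F₂ hu) (by positivity : 0 ≤ α₂ * k₂ / 2)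
    linarith
  · intro t _ hu
    have h1 := mul_le_mul_of_nonneg_left (H.F₂_le hu) (by positivity : 0 ≤ α₂ * k₂ / 2)
    linarith
  · intro t ht
    have hb := hM t ht
    have hp : |F₁ (x₁ t, x₂ t) * v₁ t| ≤ M * √(α₁ * ω₁) := by
      rw [abs_mul]
      exact mul_le_mul hb.abs_F₁ (hv₁_le t) (abs_nonneg _) hM0.le
    have hq : |F₂₁ (x₁ t, x₂ t) * v₁ t + F₂₂ (x₁ t, x₂ t) * v₂ t| ≤
        M * √(α₁ * ω₁) + M * √(α₂ * ω₂) := by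
      refine (abs_add_le _ _).trans ?_
      rw [abs_mul (F₂₁ _), abs_mul (F₂₂ _)]
      exact add_le_add (mul_le_mul hb.abs_F₂₁ (hv₁_le t) (abs_nonneg _) hM0.le)
        (mul_le_mul hb.abs_F₂₂ (hv₂_le t) (abs_nonneg _) hM0.le)
    have hh : |h' (x₁ t) * v₁ t| ≤ M * √(α₁ * ω₁) := by
      rw [abs_mul]
      exact mul_le_mul hb.abs_h' (hv₁_le t) (abs_nonneg _) hM0.le
    have hR := abs_averaged_remainder_le (b := √(α₂ * ω₂) / ω₂) (k := k₂)
      (z := α₂ * k₂ / (4 * ω₂)) (d := 0) (by positivity) hk₂.le (by positivity)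
      (Real.abs_cos_le_one (θ t)) (Real.abs_cos_le_one (2 * θ t)) (Real.abs_sin_le_one (2 * θ t))
      hb.abs_F₂ hp hq (hv₂_le t)
    rw [abs_zero, zero_mul, zero_add] at hR
    calc |r t| ≤ _ + |h' (x₁ t) * v₁ t| := abs_sub _ _
      _ ≤ _ := add_le_add hR hh
      _ ≤ _ := by
        rw [zero_mul, zero_mul, add_zero]
        rfl

/-- Sensitivity of the leader's averaged dynamics to the follower's tracking error. -/
noncomputable def leaderGain (α₁ k₁ ω₁ M : ℝ) : ℝ :=
  √(α₁ * ω₁) * (k₁ * M) * (1 + √(α₁ * ω₁) / ω₁ * k₁ * M)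

/-- The leader's state contracts to `x₁s` at rate `α₁k₁m₁/2`, up to errors that are due to averaging
and to the tracking error of the follower. -/
theorem IsNestedCost.leader_bound
    (H : IsNestedCost JL JF h h' J' J'' F₁ F₂ F₂₁ F₂₂ x₁s m₁ m₂) (hm₁ : 0 < m₁)
    (hα₁ : 0 < α₁) (hk₁ : 0 < k₁) (hω₁ : 0 < ω₁)
    (hx₁ : ∀ t ∈ Set.Ici t₀, HasDerivWithinAt x₁
      (√(α₁ * ω₁) * Real.cos (ω₁ * t + k₁ * JL (x₁ t) (x₂ t))) (Set.Ici t₀) t)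
    (hM0 : 0 < M)
    (hM : ∀ t ∈ Set.Icc t₀ T, IsNestedBound JL h h' J' J'' F₁ F₂ F₂₁ F₂₂ M (x₁ t) (x₂ t))
    {ν E δ : ℝ} (hE : 0 ≤ E) (hδ : 0 ≤ δ) (hν : α₁ * k₁ / 2 * m₁ < ν)
    (he : ∀ t ∈ Set.Icc t₀ T, |x₂ t - h (x₁ t)| ≤ E * Real.exp (-(ν * (t - t₀))) + δ)
    (hκ : avgShift α₁ k₁ ω₁ M +
      (avgDrift α₁ k₁ ω₁ M 0 (M * √(α₁ * ω₁)) + leaderGain α₁ k₁ ω₁ M * δ) /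
        (α₁ * k₁ / 2 * m₁) < κ) :
    ∀ t ∈ Set.Icc t₀ T, |x₁ t - x₁s| ≤
      |x₁ t₀ - x₁s| * Real.exp (-(α₁ * k₁ / 2 * m₁ * (t - t₀))) +
        (2 * avgShift α₁ k₁ ω₁ M + κ +
          leaderGain α₁ k₁ ω₁ M * E / (ν - α₁ * k₁ / 2 * m₁)) := by
  set v₁ : ℝ → ℝ := fun t => √(α₁ * ω₁) * Real.cos (ω₁ * t + k₁ * JL (x₁ t) (x₂ t)) with hv₁
  have hv₁_le : ∀ t, |v₁ t| ≤ √(α₁ * ω₁) := fun t => abs_mul_cos_le (Real.sqrt_nonneg _) _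
  set θ : ℝ → ℝ := fun t => ω₁ * t + k₁ * JL (x₁ t) (h (x₁ t)) with hθ
  let d : ℝ → ℝ := fun t => v₁ t - √(α₁ * ω₁) * Real.cos (θ t)
  let r : ℝ → ℝ := fun t =>
    d t - √(α₁ * ω₁) / ω₁ * k₁ * (Real.cos (θ t) * (J' (x₁ t) * d t + 0)) +
      α₁ * k₁ / (4 * ω₁) * (2 * k₁ * (Real.cos (2 * θ t) * (J' (x₁ t) * v₁ t + 0)) * J' (x₁ t) +
        Real.sin (2 * θ t) * (J'' (x₁ t) * v₁ t))
  have hμ : 0 < α₁ * k₁ / 2 * m₁ := by positivity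
  have hνμ : 0 < ν - α₁ * k₁ / 2 * m₁ := sub_pos.2 hν
  have hgain : 0 ≤ leaderGain α₁ k₁ ω₁ M := by
    unfold leaderGain
    positivity
  have hρ : 0 ≤ avgDrift α₁ k₁ ω₁ M 0 (M * √(α₁ * ω₁)) + leaderGain α₁ k₁ ω₁ M * δ :=
    add_nonneg (avgDrift_nonneg hα₁ hk₁ hω₁ hM0.le le_rfl (by positivity)) (by positivity)
  refine abs_le_exp_barrier (T := T) (K := leaderGain α₁ k₁ ω₁ M * E / (ν - α₁ * k₁ / 2 * m₁))
    (ν := ν)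
    (y := fun t => x₁ t - √(α₁ * ω₁) / ω₁ * Real.sin (θ t) +
      α₁ * k₁ / (4 * ω₁) * (Real.sin (2 * θ t) * J' (x₁ t)) - x₁s)
    (F := fun t => α₁ * k₁ / 2 * J' (x₁ t)) (r := r)
    (u := fun t => x₁ t - x₁s) hμ (by positivity) hν.le hκ hρ ?_ ?_ ?_ ?_ ?_
  · intro t ht
    have ht' : t ∈ Set.Ici t₀ := ht.1
    have hj := (H.hasDerivAt_J (x₁ t)).comp_hasDerivWithinAt t (hx₁ t ht')
    have hg := (H.hasDerivAt_J' (x₁ t)).comp_hasDerivWithinAt t (hx₁ t ht')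
    exact (hasDerivWithinAt_averaged (a := √(α₁ * ω₁)) (α := α₁) (ω := ω₁) (k := k₁)
      (j := fun t => JL (x₁ t) (h (x₁ t))) (g := fun t => J' (x₁ t)) (d := d t)
      (p := 0) hω₁ (Real.sq_sqrt (by positivity)) (hx₁ t ht')
      (hj.congr_deriv (by ring)) hg (by simp [d, hv₁, hθ])).sub_const x₁s
  · intro t ht
    have h1 := abs_averaged_shift_le (x := x₁ t) (θ := θ t) hα₁ hk₁ hω₁ (hM t ht).abs_J'
    convert h1 using 2
    ring
  · intro t _ hu
    have h1 := mul_le_mul_of_nonneg_left (H.le_J' hu) (by positivity : 0 ≤ α₁ * k₁ / 2)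
    linarith
  · intro t _ hu
    have h1 := mul_le_mul_of_nonneg_left (H.J'_le hu) (by positivity : 0 ≤ α₁ * k₁ / 2)
    linarith
  · intro t ht
    have hb := hM t ht
    have hq : |J'' (x₁ t) * v₁ t| ≤ M * √(α₁ * ω₁) := by
      rw [abs_mul]
      exact mul_le_mul hb.abs_J'' (hv₁_le t) (abs_nonneg _) hM0.le
    have hd : |d t| ≤ √(α₁ * ω₁) * (k₁ * M) * |x₂ t - h (x₁ t)| := by
      have h1 : d t = √(α₁ * ω₁) * (Real.cos (ω₁ * t + k₁ * JL (x₁ t) (x₂ t)) -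
          Real.cos (θ t)) := by simp only [d, hv₁]; ring
      have h2 : ω₁ * t + k₁ * JL (x₁ t) (x₂ t) - θ t =
          k₁ * (JL (x₁ t) (x₂ t) - JL (x₁ t) (h (x₁ t))) := by simp only [hθ]; ring
      rw [h1, abs_mul, abs_of_nonneg (Real.sqrt_nonneg _), mul_assoc]
      refine mul_le_mul_of_nonneg_left ?_ (Real.sqrt_nonneg _)
      refine (Real.abs_cos_sub_cos_le _ _).trans ?_
      rw [h2, abs_mul, abs_of_pos hk₁, mul_assoc]
      exact mul_le_mul_of_nonneg_left hb.abs_JL_sub hk₁.le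
    have hR := abs_averaged_remainder_le (b := √(α₁ * ω₁) / ω₁) (k := k₁)
      (z := α₁ * k₁ / (4 * ω₁)) (d := d t) (p := 0) (P := 0) (by positivity) hk₁.le
      (by positivity) (Real.abs_cos_le_one (θ t)) (Real.abs_cos_le_one (2 * θ t))
      (Real.abs_sin_le_one (2 * θ t)) hb.abs_J' (by simp) hq (hv₁_le t)
    have hd' : |d t| * (1 + √(α₁ * ω₁) / ω₁ * k₁ * M) ≤
        leaderGain α₁ k₁ ω₁ M * (E * Real.exp (-(ν * (t - t₀))) + δ) := by
      calc _ ≤ √(α₁ * ω₁) * (k₁ * M) * |x₂ t - h (x₁ t)| *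
            (1 + √(α₁ * ω₁) / ω₁ * k₁ * M) := by gcongr
        _ = leaderGain α₁ k₁ ω₁ M * |x₂ t - h (x₁ t)| := by unfold leaderGain; ring
        _ ≤ _ := mul_le_mul_of_nonneg_left (he t ht) hgain
    have hK : leaderGain α₁ k₁ ω₁ M * E / (ν - α₁ * k₁ / 2 * m₁) * (ν - α₁ * k₁ / 2 * m₁) =
        leaderGain α₁ k₁ ω₁ M * E := div_mul_cancel₀ _ hνμ.ne'
    rw [hK]
    have hRd : |r t| ≤ |d t| * (1 + √(α₁ * ω₁) / ω₁ * k₁ * M) +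
        avgDrift α₁ k₁ ω₁ M 0 (M * √(α₁ * ω₁)) := by
      unfold avgDrift
      rw [← add_assoc]
      exact hR
    linarith

/-- Conditions on the parameters under which trajectories that start within distance `N` satisfy
the stability estimate with error `δ`. -/
structure IsTuned (α₁ k₁ ω₁ α₂ k₂ ω₂ m₁ m₂ M N δ κ₁ κ₂ : ℝ) : Prop where
  one_le_rate : 1 ≤ α₂ * k₂ / 2 * m₂
  rate_lt : α₁ * k₁ / 2 * m₁ < α₂ * k₂ / 2 * m₂
  follower : avgShift α₂ k₂ ω₂ M +
    (avgDrift α₂ k₂ ω₂ M (M * √(α₁ * ω₁)) (M * √(α₁ * ω₁) + M * √(α₂ * ω₂)) +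
      M * √(α₁ * ω₁)) / (α₂ * k₂ / 2 * m₂) < κ₂
  follower_le : 2 * avgShift α₂ k₂ ω₂ M + κ₂ ≤ δ
  leader : avgShift α₁ k₁ ω₁ M +
      (avgDrift α₁ k₁ ω₁ M 0 (M * √(α₁ * ω₁)) +
        leaderGain α₁ k₁ ω₁ M * (2 * avgShift α₂ k₂ ω₂ M + κ₂)) / (α₁ * k₁ / 2 * m₁) < κ₁
  leader_le : 2 * avgShift α₁ k₁ ω₁ M + κ₁ +
    leaderGain α₁ k₁ ω₁ M * N / (α₂ * k₂ / 2 * m₂ - α₁ * k₁ / 2 * m₁) ≤ δ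

/-- The stability estimate, separately for the leader's error and the follower's tracking error. -/
theorem IsNestedCost.trajectory_bound
    (H : IsNestedCost JL JF h h' J' J'' F₁ F₂ F₂₁ F₂₂ x₁s m₁ m₂) (hm₁ : 0 < m₁) (hm₂ : 0 < m₂)
    (hα₁ : 0 < α₁) (hk₁ : 0 < k₁) (hω₁ : 0 < ω₁) (hα₂ : 0 < α₂) (hk₂ : 0 < k₂) (hω₂ : 0 < ω₂)
    {N δ κ₁ κ₂ : ℝ} (hδ1 : δ < 1) (hM0 : 0 < M)
    (hM : ∀ x₁ x₂, |x₁ - x₁s| ≤ N + 1 → |x₂ - h x₁| ≤ N + 1 →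
      IsNestedBound JL h h' J' J'' F₁ F₂ F₂₁ F₂₂ M x₁ x₂)
    (htuned : IsTuned α₁ k₁ ω₁ α₂ k₂ ω₂ m₁ m₂ M N δ κ₁ κ₂)
    (hx₁ : ∀ t ∈ Set.Ici t₀, HasDerivWithinAt x₁
      (√(α₁ * ω₁) * Real.cos (ω₁ * t + k₁ * JL (x₁ t) (x₂ t))) (Set.Ici t₀) t)
    (hx₂ : ∀ t ∈ Set.Ici t₀, HasDerivWithinAt x₂
      (√(α₂ * ω₂) * Real.cos (ω₂ * t + k₂ * JF (x₁ t) (x₂ t))) (Set.Ici t₀) t)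
    (h₁ : |x₁ t₀ - x₁s| ≤ N) (h₂ : |x₂ t₀ - h (x₁ t₀)| ≤ N) :
    ∀ t, t₀ ≤ t →
      |x₁ t - x₁s| ≤ |x₁ t₀ - x₁s| * Real.exp (-(α₁ * k₁ / 2 * m₁ * (t - t₀))) + δ ∧
      |x₂ t - h (x₁ t)| ≤ |x₂ t₀ - h (x₁ t₀)| * Real.exp (-(t - t₀)) + δ := by
  have hbox : ∀ T, t₀ ≤ T →
      (∀ t ∈ Set.Icc t₀ T, |x₁ t - x₁s| ≤ N + 1 ∧ |x₂ t - h (x₁ t)| ≤ N + 1) →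
      |x₁ T - x₁s| ≤ |x₁ t₀ - x₁s| * Real.exp (-(α₁ * k₁ / 2 * m₁ * (T - t₀))) + δ ∧
      |x₂ T - h (x₁ T)| ≤ |x₂ t₀ - h (x₁ t₀)| * Real.exp (-(T - t₀)) + δ := by
    intro T hT hin
    have hMt : ∀ t ∈ Set.Icc t₀ T,
        IsNestedBound JL h h' J' J'' F₁ F₂ F₂₁ F₂₂ M (x₁ t) (x₂ t) :=
      fun t ht => hM _ _ (hin t ht).1 (hin t ht).2
    have hf := H.follower_bound hm₂ hα₂ hk₂ hω₂ hx₁ hx₂ hM0 hMt htuned.follower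
    have hs₂ : 0 ≤ avgShift α₂ k₂ ω₂ M := by
      unfold avgShift
      positivity
    have hκ₂ : 0 ≤ κ₂ := by
      refine le_trans (add_nonneg hs₂ (div_nonneg (add_nonneg (avgDrift_nonneg hα₂ hk₂ hω₂ hM0.le
        ?_ ?_) ?_) ?_)) htuned.follower.le <;> positivity
    have hl := H.leader_bound hm₁ hα₁ hk₁ hω₁ hx₁ hM0 hMt (abs_nonneg _)
      (by positivity) htuned.rate_lt hf htuned.leader
    have hTmem : T ∈ Set.Icc t₀ T := ⟨hT, le_rfl⟩
    have hgap : 0 < α₂ * k₂ / 2 * m₂ - α₁ * k₁ / 2 * m₁ := sub_pos.2 htuned.rate_lt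
    constructor
    · refine (hl T hTmem).trans (add_le_add_right ?_ _)
      refine le_trans (add_le_add_right ?_ _) htuned.leader_le
      have hgain : 0 ≤ leaderGain α₁ k₁ ω₁ M := by
        unfold leaderGain
        positivity
      gcongr
    · refine (hf T hTmem).trans (add_le_add (mul_le_mul_of_nonneg_left ?_ (abs_nonneg _))
        htuned.follower_le)
      refine Real.exp_le_exp.2 (neg_le_neg ?_)
      exact le_mul_of_one_le_left (sub_nonneg.2 hT) htuned.one_le_rate
  have hc₁ : ContinuousOn x₁ (Set.Ici t₀) := fun t ht => (hx₁ t ht).continuousWithinAt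
  have hc₂ : ContinuousOn x₂ (Set.Ici t₀) := fun t ht => (hx₂ t ht).continuousWithinAt
  have hch : Continuous h :=
    continuous_iff_continuousAt.2 fun x => (H.hasDerivAt_h x).continuousAt
  have hstay := nonpos_of_forall_le_nonpos_imp_neg (t₀ := t₀)
    (g := fun t => max |x₁ t - x₁s| |x₂ t - h (x₁ t)| - (N + 1)) ?_ ?_ ?_
  · intro t ht
    refine hbox t ht fun s hs => ?_
    have h3 := sub_nonpos.1 (hstay s hs.1)
    exact ⟨(le_max_left _ _).trans h3, (le_max_right _ _).trans h3⟩
  · fun_prop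
  · have h3 := max_le h₁ h₂
    linarith
  · intro t ht hs
    obtain ⟨h3, h4⟩ := hbox t ht fun s hs' => by
      have h3 := sub_nonpos.1 (hs s hs')
      exact ⟨(le_max_left _ _).trans h3, (le_max_right _ _).trans h3⟩
    have h5 : |x₁ t₀ - x₁s| * Real.exp (-(α₁ * k₁ / 2 * m₁ * (t - t₀))) ≤ |x₁ t₀ - x₁s| :=
      mul_le_of_le_one_right (abs_nonneg _) (Real.exp_le_one_iff.2 (neg_nonpos.2
        (mul_nonneg (by positivity) (sub_nonneg.2 ht))))
    have h6 : |x₂ t₀ - h (x₁ t₀)| * Real.exp (-(t - t₀)) ≤ |x₂ t₀ - h (x₁ t₀)| :=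
      mul_le_of_le_one_right (abs_nonneg _) (Real.exp_le_one_iff.2 (neg_nonpos.2
        (sub_nonneg.2 ht)))
    refine sub_neg.2 (max_lt ?_ ?_) <;> linarith

end Trajectory

open Filter in
theorem tendsto_sqrt_mul_div_atTop (α : ℝ) :
    Tendsto (fun ω : ℝ => √(α * ω) / ω) atTop (nhds 0) := by
  have h1 : Tendsto (fun ω : ℝ => √α * (√ω)⁻¹) atTop (nhds (√α * 0)) :=
    (tendsto_inv_atTop_zero.comp Real.tendsto_sqrt_atTop).const_mul _
  rw [mul_zero] at h1
  refine h1.congr' ?_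
  filter_upwards [eventually_gt_atTop 0] with ω hω
  rw [Real.sqrt_mul' _ hω.le, mul_div_assoc, Real.sqrt_div_self]

open Filter in
theorem tendsto_avgShift (α k G : ℝ) :
    Tendsto (fun ω => avgShift α k ω G) atTop (nhds 0) := by
  have h1 := (tendsto_sqrt_mul_div_atTop α).add
    (tendsto_inv_atTop_zero.const_mul (α * k / 4 * G))
  rw [mul_zero, add_zero] at h1
  refine h1.congr fun ω => ?_
  unfold avgShift
  ring

open Filter in
theorem tendsto_avgDrift (α k G P Q R : ℝ) :
    Tendsto (fun ω => avgDrift α k ω G P (Q + R * √(α * ω))) atTop (nhds 0) := by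
  have h1 := ((tendsto_sqrt_mul_div_atTop α).const_mul
    (k * P + α * k / 4 * (2 * k * G * G + R))).add
    (tendsto_inv_atTop_zero.const_mul (α * k / 4 * (2 * k * P * G + Q)))
  rw [mul_zero, mul_zero, add_zero] at h1
  refine h1.congr fun ω => ?_
  unfold avgDrift
  ring

open Filter in
/-- The parameters can be tuned in the order `ω₁`, `k₂`, `ω₂`. -/
theorem eventually_isTuned {α₁ k₁ α₂ m₁ m₂ M N δ : ℝ} (hα₁ : 0 < α₁) (hk₁ : 0 < k₁)
    (hα₂ : 0 < α₂) (hm₁ : 0 < m₁) (hm₂ : 0 < m₂) (hM : 0 < M) (hδ : 0 < δ) :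
    ∀ᶠ ω₁ in atTop, ∀ᶠ k₂ in atTop, ∀ᶠ ω₂ in atTop, ∃ κ₁ κ₂,
      IsTuned α₁ k₁ ω₁ α₂ k₂ ω₂ m₁ m₂ M N δ κ₁ κ₂ := by
  set μ₁ := α₁ * k₁ / 2 * m₁ with hμ₁
  have hμ₁0 : 0 < μ₁ := by positivity
  have hdrift := tendsto_avgDrift α₁ k₁ M 0 0 M
  simp only [zero_add] at hdrift
  filter_upwards [(tendsto_avgShift α₁ k₁ M).eventually_lt_const (by positivity : 0 < δ / 8),
    hdrift.eventually_lt_const (by positivity : 0 < μ₁ * (δ / 8)), eventually_gt_atTop 0]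
    with ω₁ hs₁ hd₁ hω₁
  set g := leaderGain α₁ k₁ ω₁ M with hg
  have hg0 : 0 ≤ g := by
    rw [hg]
    unfold leaderGain
    positivity
  set τ := min (δ / 2) (δ * μ₁ / (8 * (g + 1))) with hτ
  have hτ0 : 0 < τ := lt_min (by positivity) (by positivity)
  have hτδ : τ ≤ δ / 2 := min_le_left _ _
  have hgτ : g * (2 * τ) ≤ μ₁ * (δ / 4) := by
    have h1 : τ * (8 * (g + 1)) ≤ δ * μ₁ :=
      (le_div_iff₀ (by positivity)).1 (min_le_right _ _)
    linarith
  have hμ₂ : Tendsto (fun k₂ => α₂ * k₂ / 2 * m₂) atTop atTop := by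
    have h1 := (tendsto_id (α := ℝ) (x := atTop)).const_mul_atTop
      (by positivity : 0 < α₂ / 2 * m₂)
    refine h1.congr fun k => ?_
    simp only [id]
    ring
  have hA : 0 ≤ M * √(α₁ * ω₁) := by positivity
  filter_upwards [hμ₂.eventually_ge_atTop 1, hμ₂.eventually_gt_atTop μ₁,
    hμ₂.eventually_ge_atTop (μ₁ + g * N / (δ / 4)),
    hμ₂.eventually_ge_atTop ((1 + M * √(α₁ * ω₁)) / (τ / 2))] with k₂ h1 hgt hgN hτμ
  set μ₂ := α₂ * k₂ / 2 * m₂ with hμ₂def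
  have hμ₂0 : 0 < μ₂ := by linarith
  filter_upwards [(tendsto_avgShift α₂ k₂ M).eventually_lt_const (by positivity : 0 < τ / 4),
    (tendsto_avgDrift α₂ k₂ M (M * √(α₁ * ω₁)) (M * √(α₁ * ω₁)) M).eventually_lt_const one_pos]
    with ω₂ hs₂ hd₂
  refine ⟨δ / 2, τ, h1, hgt, ?_, by linarith, ?_, ?_⟩
  · have h2 : (avgDrift α₂ k₂ ω₂ M (M * √(α₁ * ω₁)) (M * √(α₁ * ω₁) + M * √(α₂ * ω₂)) +
        M * √(α₁ * ω₁)) / μ₂ ≤ τ / 2 := by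
      rw [div_le_iff₀ hμ₂0]
      have h3 := (div_le_iff₀ (by positivity)).1 hτμ
      linarith
    linarith
  · have h2 : (avgDrift α₁ k₁ ω₁ M 0 (M * √(α₁ * ω₁)) +
        g * (2 * avgShift α₂ k₂ ω₂ M + τ)) / μ₁ ≤ δ / 8 + δ / 4 := by
      rw [div_le_iff₀ hμ₁0]
      have h3 : g * (2 * avgShift α₂ k₂ ω₂ M + τ) ≤ g * (2 * τ) :=
        mul_le_mul_of_nonneg_left (by linarith) hg0
      linarith
    linarith
  · have h2 : g * N / (μ₂ - μ₁) ≤ δ / 4 := by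
      rw [div_le_iff₀ (sub_pos.2 hgt)]
      have h3 : g * N / (δ / 4) ≤ μ₂ - μ₁ := by linarith
      rw [div_le_iff₀ (by positivity)] at h3
      linarith
    linarith

theorem EuclideanSpace.norm_fin_two_le (y : EuclideanSpace ℝ (Fin 2)) : ‖y‖ ≤ |y 0| + |y 1| := by
  rw [EuclideanSpace.norm_eq, Fin.sum_univ_two, Real.norm_eq_abs, Real.norm_eq_abs]
  refine Real.sqrt_le_iff.2 ⟨by positivity, ?_⟩
  nlinarith [mul_nonneg (abs_nonneg (y 0)) (abs_nonneg (y 1))]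

theorem IsIntegralCurveOn.hasDerivWithinAt_apply {x : ℝ → EuclideanSpace ℝ (Fin 2)}
    {f : ℝ → EuclideanSpace ℝ (Fin 2) → EuclideanSpace ℝ (Fin 2)} {s : Set ℝ}
    (hx : IsIntegralCurveOn x f s) (i : Fin 2) {t : ℝ} (ht : t ∈ s) :
    HasDerivWithinAt (fun t => x t i) (f t (x t) i) s t :=
  (EuclideanSpace.proj (𝕜 := ℝ) i :
    EuclideanSpace ℝ (Fin 2) →L[ℝ] ℝ).hasFDerivAt.comp_hasDerivWithinAt t (hx t ht)

theorem exists_isIntegralCurveOn_nesField {JL JF : ℝ → ℝ → ℝ}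
    (hJL : ContDiff ℝ 1 (fun p : ℝ × ℝ => JL p.1 p.2))
    (hJF : ContDiff ℝ 1 (fun p : ℝ × ℝ => JF p.1 p.2)) (α₁ k₁ ω₁ α₂ k₂ ω₂ t₀ : ℝ)
    (x₀ : EuclideanSpace ℝ (Fin 2)) :
    ∃ x : ℝ → EuclideanSpace ℝ (Fin 2), x t₀ = x₀ ∧
      IsIntegralCurveOn x (nesField JL JF α₁ k₁ ω₁ α₂ k₂ ω₂) (Set.Ici t₀) := by
  have hosc : ∀ {J : ℝ → ℝ → ℝ}, ContDiff ℝ 1 (fun p : ℝ × ℝ => J p.1 p.2) → ∀ a k ω R : ℝ,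
      ∃ K : NNReal, ∀ t, ∀ x ∈ Metric.closedBall (0 : EuclideanSpace ℝ (Fin 2)) R,
        ∀ y ∈ Metric.closedBall (0 : EuclideanSpace ℝ (Fin 2)) R,
        |√a * Real.cos (ω * t + k * J (x 0) (x 1)) - √a * Real.cos (ω * t + k * J (y 0) (y 1))| ≤
          K * ‖x - y‖ := by
    intro J hJ a k ω R
    have hJ' : ContDiff ℝ 1 fun x : EuclideanSpace ℝ (Fin 2) => J (x 0) (x 1) :=
      hJ.comp (f := fun x : EuclideanSpace ℝ (Fin 2) => (x 0, x 1)) (by fun_prop)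
    obtain ⟨K, hK⟩ := (hJ'.locallyLipschitz.locallyLipschitzOn
      (s := Metric.closedBall 0 R)).exists_lipschitzOnWith_of_compact (isCompact_closedBall 0 R)
    refine ⟨(√a).toNNReal * (|k|).toNNReal * K, fun t x hx y hy => ?_⟩
    have h1 := hK.dist_le_mul x hx y hy
    rw [Real.dist_eq, dist_eq_norm] at h1
    have h2 : |Real.cos (ω * t + k * J (x 0) (x 1)) - Real.cos (ω * t + k * J (y 0) (y 1))| ≤
        |k| * |J (x 0) (x 1) - J (y 0) (y 1)| := by
      rw [← abs_mul]
      refine (Real.abs_cos_sub_cos_le _ _).trans (le_of_eq ?_)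
      congr 1
      ring
    rw [← mul_sub, abs_mul, abs_of_nonneg (Real.sqrt_nonneg _)]
    push_cast
    rw [Real.coe_toNNReal _ (Real.sqrt_nonneg _), Real.coe_toNNReal _ (abs_nonneg _), mul_assoc,
      mul_assoc]
    refine mul_le_mul_of_nonneg_left (h2.trans ?_) (Real.sqrt_nonneg _)
    exact mul_le_mul_of_nonneg_left h1 (abs_nonneg _)
  refine exists_isIntegralCurveOn_Ici_of_bounded (L := √(α₁ * ω₁) + √(α₂ * ω₂)) ?_ ?_ ?_ t₀ x₀
  · intro t x
    refine (EuclideanSpace.norm_fin_two_le _).trans (add_le_add ?_ ?_)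
    · exact abs_mul_cos_le (Real.sqrt_nonneg _) _
    · exact abs_mul_cos_le (Real.sqrt_nonneg _) _
  · intro x
    refine (PiLp.continuous_toLp 2 _).comp (continuous_pi fun i => ?_)
    fin_cases i
    · change Continuous fun t => √(α₁ * ω₁) * Real.cos (ω₁ * t + k₁ * JL (x 0) (x 1))
      fun_prop
    · change Continuous fun t => √(α₂ * ω₂) * Real.cos (ω₂ * t + k₂ * JF (x 0) (x 1))
      fun_prop
  · intro R
    obtain ⟨K₁, hK₁⟩ := hosc hJL (α₁ * ω₁) k₁ ω₁ R
    obtain ⟨K₂, hK₂⟩ := hosc hJF (α₂ * ω₂) k₂ ω₂ R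
    refine ⟨K₁ + K₂, fun t => LipschitzOnWith.of_dist_le_mul fun x hx y hy => ?_⟩
    rw [dist_eq_norm, dist_eq_norm]
    refine (EuclideanSpace.norm_fin_two_le _).trans ?_
    push_cast
    rw [add_mul]
    exact add_le_add (hK₁ t x hx y hy) (hK₂ t x hx y hy)

open Filter in
/-- Iterated "for all large" statements have positive thresholds depending on the earlier
variables. -/
theorem exists_thresholds {Q : ℝ → ℝ → ℝ → ℝ → Prop}
    (hQ : ∀ υ, 0 < υ → ∀ᶠ a in atTop, ∀ᶠ b in atTop, ∀ᶠ c in atTop, Q υ a b c) :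
    ∃ (A : ℝ → ℝ) (B : ℝ → ℝ → ℝ) (C : ℝ → ℝ → ℝ → ℝ),
      (∀ υ, 0 < A υ) ∧ (∀ υ a, 0 < B υ a) ∧ (∀ υ a b, 0 < C υ a b) ∧
      ∀ υ, 0 < υ → ∀ a, A υ < a → ∀ b, B υ a < b → ∀ c, C υ a b < c → Q υ a b c := by
  have hpos : ∀ P : ℝ → Prop, ∃ A : ℝ, 0 < A ∧ ((∀ᶠ a in atTop, P a) → ∀ a, A < a → P a) := by
    intro P
    by_cases hP : ∀ᶠ a in atTop, P a
    · obtain ⟨A, hA⟩ := eventually_atTop.1 hP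
      exact ⟨max A 1, by positivity, fun _ a ha => hA a ((le_max_left _ _).trans ha.le)⟩
    · exact ⟨1, one_pos, fun h => absurd h hP⟩
  choose thr hthr0 hthr using hpos
  refine ⟨fun υ => thr fun a => ∀ᶠ b in atTop, ∀ᶠ c in atTop, Q υ a b c,
    fun υ a => thr fun b => ∀ᶠ c in atTop, Q υ a b c, fun υ a b => thr fun c => Q υ a b c,
    fun _ => hthr0 _, fun _ _ => hthr0 _, fun _ _ _ => hthr0 _, ?_⟩
  intro υ hυ a ha b hb c hc
  exact hthr _ (hthr _ (hthr _ (hQ υ hυ) a ha) b hb) c hc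

open Filter in
theorem IsNestedCost.eventually_norm_sub_le {JL JF : ℝ → ℝ → ℝ} {h h' J' J'' : ℝ → ℝ}
    {F₁ F₂ F₂₁ F₂₂ : ℝ × ℝ → ℝ} {x₁s m₁ m₂ : ℝ}
    (H : IsNestedCost JL JF h h' J' J'' F₁ F₂ F₂₁ F₂₂ x₁s m₁ m₂) (hm₁ : 0 < m₁) (hm₂ : 0 < m₂)
    {α₁ k₁ α₂ : ℝ} (hα₁ : 0 < α₁) (hk₁ : 0 < k₁) (hα₂ : 0 < α₂)
    {γ : ℝ → ℝ} (hγc : Continuous γ) (hγm : StrictMono γ) (hγ0 : γ 0 = 0)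
    (hγ : ∀ u, |h u - h x₁s| ≤ γ |u - x₁s|) {R υ : ℝ} (hR : 0 ≤ R) (hυ : 0 < υ) :
    ∀ᶠ ω₁ in atTop, ∀ᶠ k₂ in atTop, ∀ᶠ ω₂ in atTop,
      ∀ (t₀ : ℝ) (x : ℝ → EuclideanSpace ℝ (Fin 2)), ‖x t₀ - !₂[x₁s, h x₁s]‖ ≤ R →
        IsIntegralCurveOn x (nesField JL JF α₁ k₁ ω₁ α₂ k₂ ω₂) (Set.Ici t₀) → ∀ t, t₀ ≤ t →
        ‖x t - !₂[x₁s, h x₁s]‖ ≤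
          ‖x t₀ - !₂[x₁s, h x₁s]‖ * Real.exp (-(α₁ * k₁ / 2 * m₁ * (t - t₀))) +
          (‖x t₀ - !₂[x₁s, h x₁s]‖ + γ ‖x t₀ - !₂[x₁s, h x₁s]‖) * Real.exp (-(t - t₀)) +
          γ (2 * (‖x t₀ - !₂[x₁s, h x₁s]‖ *
            Real.exp (-(α₁ * k₁ / 2 * m₁ * (t - t₀))))) + υ := by
  have hγnn : ∀ r, 0 ≤ r → 0 ≤ γ r := fun r hr => hγ0 ▸ hγm.monotone hr
  obtain ⟨δ, hδυ, hδ0, hδ1⟩ : ∃ δ : ℝ, 2 * δ + γ (2 * δ) < υ ∧ 0 < δ ∧ δ < 1 := by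
    have hlim : Tendsto (fun δ : ℝ => 2 * δ + γ (2 * δ)) (nhdsWithin 0 (Set.Ioi 0)) (nhds 0) := by
      have h1 : Continuous fun δ : ℝ => 2 * δ + γ (2 * δ) := by fun_prop
      have h2 := h1.tendsto 0
      simp only [mul_zero, hγ0, add_zero] at h2
      exact h2.mono_left nhdsWithin_le_nhds
    exact ((hlim.eventually_lt_const hυ).and
      (Ioo_mem_nhdsGT (one_pos : (0 : ℝ) < 1))).exists
  have hN : 0 ≤ R + γ R := add_nonneg hR (hγnn R hR)
  obtain ⟨M, hM0, hM⟩ := H.exists_bound (R := R + γ R + 1) (by positivity)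
  filter_upwards [eventually_isTuned (N := R + γ R) hα₁ hk₁ hα₂ hm₁ hm₂ hM0 hδ0,
    eventually_gt_atTop 0] with ω₁ htuned₁ hω₁
  filter_upwards [htuned₁, eventually_gt_atTop 0] with k₂ htuned₂ hk₂
  filter_upwards [htuned₂, eventually_gt_atTop 0] with ω₂ htuned hω₂
  obtain ⟨κ₁, κ₂, htuned⟩ := htuned
  intro t₀ x hx₀ hx t ht
  set r := ‖x t₀ - !₂[x₁s, h x₁s]‖ with hr
  have hr0 : 0 ≤ r := norm_nonneg _
  have ha : |x t₀ 0 - x₁s| ≤ r := PiLp.norm_apply_le (x t₀ - !₂[x₁s, h x₁s]) 0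
  have hb : |x t₀ 1 - h x₁s| ≤ r := PiLp.norm_apply_le (x t₀ - !₂[x₁s, h x₁s]) 1
  have hγr : |h (x t₀ 0) - h x₁s| ≤ γ r := (hγ _).trans (hγm.monotone ha)
  have he : |x t₀ 1 - h (x t₀ 0)| ≤ r + γ r := by
    have h1 := abs_sub_le (x t₀ 1) (h x₁s) (h (x t₀ 0))
    rw [abs_sub_comm (h x₁s)] at h1
    linarith
  have hγR : γ r ≤ γ R := hγm.monotone hx₀
  obtain ⟨hl, hf⟩ := H.trajectory_bound (x₁ := fun t => x t 0) (x₂ := fun t => x t 1) hm₁ hm₂ hα₁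
    hk₁ hω₁ hα₂ hk₂ hω₂ hδ1 hM0 hM htuned (fun t ht => hx.hasDerivWithinAt_apply 0 ht)
    (fun t ht => hx.hasDerivWithinAt_apply 1 ht) (by linarith [hγnn R hR])
    (by linarith) t ht
  dsimp only at hl hf
  set e₁ := Real.exp (-(α₁ * k₁ / 2 * m₁ * (t - t₀))) with he₁
  set e₂ := Real.exp (-(t - t₀)) with he₂
  have he₁0 : 0 < e₁ := Real.exp_pos _
  have he₂0 : 0 < e₂ := Real.exp_pos _
  have hl' : |x t 0 - x₁s| ≤ r * e₁ + δ :=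
    hl.trans (add_le_add_left (mul_le_mul_of_nonneg_right ha he₁0.le) _)
  have hf' : |x t 1 - h (x t 0)| ≤ (r + γ r) * e₂ + δ :=
    hf.trans (add_le_add_left (mul_le_mul_of_nonneg_right he he₂0.le) _)
  have hre : 0 ≤ r * e₁ := by positivity
  have hγsum : γ (r * e₁ + δ) ≤ γ (2 * (r * e₁)) + γ (2 * δ) := by
    rcases le_total (r * e₁) δ with h1 | h1
    · linarith [hγm.monotone (by linarith : r * e₁ + δ ≤ 2 * δ),
        hγnn (2 * (r * e₁)) (by linarith)]
    · linarith [hγm.monotone (by linarith : r * e₁ + δ ≤ 2 * (r * e₁)),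
        hγnn (2 * δ) (by linarith)]
  have hg : |h (x t 0) - h x₁s| ≤ γ (r * e₁ + δ) := (hγ _).trans (hγm.monotone hl')
  have hn : ‖x t - !₂[x₁s, h x₁s]‖ ≤ |x t 0 - x₁s| + |x t 1 - h x₁s| :=
    EuclideanSpace.norm_fin_two_le (x t - !₂[x₁s, h x₁s])
  linarith [abs_sub_le (x t 1) (h (x t 0)) (h x₁s)]

theorem theorem3
    (JL JF : ℝ → ℝ → ℝ) (h : ℝ → ℝ) (x₁s m₁ m₂ : ℝ)
    -- smoothness of the costs
    (hJL : ContDiff ℝ 2 (fun p : ℝ × ℝ => JL p.1 p.2))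
    (hJF : ContDiff ℝ 3 (fun p : ℝ × ℝ => JF p.1 p.2))
    -- `h x₁` is the unique root of `∂₂ J_F(x₁, ·)`, and `h` is `C¹`
    (hroot : ∀ x₁ x₂ : ℝ, deriv (JF x₁) x₂ = 0 ↔ x₂ = h x₁)
    (hh : ContDiff ℝ 1 h)
    -- strong convexity of the follower's cost
    (hm₂ : 0 < m₂) (hconvF : ∀ x₁ x₂ : ℝ, m₂ ≤ iteratedDeriv 2 (JF x₁) x₂)
    -- stationarity at `x₁s` and strong convexity of the leader's reduced cost
    (hcrit : deriv (fun x₁ => JL x₁ (h x₁)) x₁s = 0)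
    (hm₁ : 0 < m₁) (hconvL : ∀ x₁ : ℝ, m₁ ≤ iteratedDeriv 2 (fun x => JL x (h x)) x₁)
    -- fixed design parameters
    (α₁ k₁ α₂ : ℝ) (hα₁ : 0 < α₁) (hk₁ : 0 < k₁) (hα₂ : 0 < α₂) :
    ∃ (ω₁s : ℝ → ℝ) (εs : ℝ → ℝ → ℝ) (ω₂s : ℝ → ℝ → ℝ → ℝ),
      (∀ υ, 0 < ω₁s υ) ∧ (∀ υ ω₁, 0 < εs υ ω₁) ∧ (∀ υ ω₁ ε, 0 < ω₂s υ ω₁ ε) ∧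
      IsSPUAS
        (fun υ => {f | ∃ ω₁ k₂ ω₂ ε : ℝ, 0 < k₂ ∧ ε = 1 / (α₂ * k₂) ∧
          ω₁s υ < ω₁ ∧ ε < εs υ ω₁ ∧ ω₂s υ ω₁ ε < ω₂ ∧
          f = nesField JL JF α₁ k₁ ω₁ α₂ k₂ ω₂})
        !₂[x₁s, h x₁s] := by
  obtain ⟨h', J', J'', F₁, F₂, F₂₁, F₂₂, H⟩ :=
    exists_isNestedCost hJL hJF hroot hh hm₂ hconvF hcrit hconvL
  obtain ⟨γ, hγc, hγm, hγ0, hγ⟩ := hh.exists_strictMono_modulus x₁s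
  obtain ⟨A, B, C, hA, hB, hC, hABC⟩ := exists_thresholds fun υ hυ =>
    H.eventually_norm_sub_le hm₁ hm₂ hα₁ hk₁ hα₂ hγc hγm hγ0 hγ
      (by positivity : 0 ≤ 1 / υ) hυ
  refine ⟨A, fun υ ω₁ => 1 / (α₂ * B υ ω₁), fun υ ω₁ ε => C υ ω₁ (1 / (α₂ * ε)), hA,
    fun υ ω₁ => one_div_pos.2 (mul_pos hα₂ (hB υ ω₁)), fun υ ω₁ ε => hC _ _ _, _, id,
    isClassKL_of_modulus hγc hγm hγ0 (c := α₁ * k₁ / 2 * m₁) (by positivity),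
    ⟨⟨continuousOn_id, strictMonoOn_id, rfl⟩, Filter.tendsto_id⟩, fun K hK => ?_⟩
  obtain ⟨R, hR0, hR⟩ : ∃ R : ℝ, 0 < R ∧ ∀ x ∈ K, ‖x - !₂[x₁s, h x₁s]‖ ≤ R := by
    obtain ⟨R, hR⟩ := hK.exists_bound_of_continuousOn (f := fun x => x - !₂[x₁s, h x₁s])
      (by fun_prop)
    exact ⟨max R 1, by positivity, fun x hx => (hR x hx).trans (le_max_left _ _)⟩
  refine ⟨1 / R, by positivity, ?_⟩
  rintro υ hυ hυR _ ⟨ω₁, k₂, ω₂, ε, hk₂, rfl, hω₁, hε, hω₂, rfl⟩ t₀ x₀ hx₀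
  refine ⟨exists_isIntegralCurveOn_nesField (hJL.of_le (by norm_num)) (hJF.of_le (by norm_num))
    _ _ _ _ _ _ t₀ x₀, ?_⟩
  rintro x rfl hx t ht
  have hBk : B υ ω₁ < k₂ := by
    have h1 := (one_div_lt_one_div (mul_pos hα₂ hk₂) (mul_pos hα₂ (hB υ ω₁))).1 hε
    exact lt_of_mul_lt_mul_left h1 hα₂.le
  have hkε : 1 / (α₂ * (1 / (α₂ * k₂))) = k₂ := by
    field_simp
  simp only [hkε] at hω₂
  have hRυ : R ≤ 1 / υ := by
    rw [le_div_iff₀ hυ]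
    rw [lt_div_iff₀ hR0] at hυR
    linarith
  exact hABC υ hυ ω₁ hω₁ k₂ hBk ω₂ hω₂ t₀ x ((hR _ hx₀).trans hRυ) hx t ht
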